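/- **Δ-groups.** Let $G$ be a group. A $\Delta$-group based at $G$ is a family of sets $T(g,h)$, $g,h\in G$, with operations $$m:T(g,h^{-1})\times T(h,k^{-1})\times T(h^{-1}g,k^{-1}h)\to T(g,k^{-1}),\quad P:T(g,h)\to T(h,g^{-1}h^{-1}),\quad Q:T(g,h)\to T(g^{-1},hg)$$ such that $P^3=\mathrm{id}$, $Q^2=\mathrm{id}$, $P^2Q=QP$, $P(m(a,b,c))=m(P(b),P(c),P(a))$, $Q(m(a,b,c))=m(Q(a),Q(c),Q(b))$, $m(m(a,b,c),d,e)=m(a,m(b,d,f),m(c,Q(f),e))$ and $m(m(f,a,b),P^2Q(a),PQ(b))=f$ whenever these expressions make sense. A morphism from a $\Delta$-group $T$ based at $G$ to a $\Delta$-group $T'$ based at $G'$, over a homomorphism $\varphi:G\to G'$, is a family of maps $T(g,h)\to T'(\varphi(g),\varphi(h))$ that commute with $m$, $P$ and $Q$. **The construction.** Let $M$ be a topological space (for example a manifold) with base point $m_0$. A choice of based curves is a section $s$ of the projection from the loops at $m_0$ to $\pi_1(M,m_0)$ such that $s(\alpha^{-1})$ is the reverse of $s(\alpha)$ and $s(1)$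 is constant. Let $\Delta_n$ be the standard $n$-simplex with vertices $[0],\dots,[n]$. In $\pi_1$ the product $\beta\alpha$ is the class of "first $\alpha$, then $\beta$". For $\alpha,\beta\in\pi_1(M,m_0)$ let $\Gamma(\alpha,\beta)$ be the set of homotopy classes relative to $\partial\Delta_2$ of maps $a:\Delta_2\to M$ whose restrictions to the edges from $[0]$ to $[1]$, from $[1]$ to $[2]$ and from $[0]$ to $[2]$ are $s(\alpha)$, $s(\beta)$ and $s(\beta\alpha)$. Put $P[a]=[a\circ p]$ and $Q[a]=[a\circ q]$, where $p(x_0,x_1,x_2)=(x_2,x_0,x_1)$ and $q(x_0,x_1,x_2)=(x_1,x_0,x_2)$. For $a,b,c$ representing elements of $\Gamma(\alpha,\beta^{-1})$, $\Gamma(\beta,\gamma^{-1})$, $\Gamma(\beta^{-1}\alpha,\gamma^{-1}\beta)$ let $m([a],[b],[c])=[\omega|_{[1,2,3]}]$, where $\omega:\Delta_3\to M$ is a map with $\omega|_{[1,2,0]}=a$, $\omega|_{[0,2,3]}=b$, $\omega|_{[1,0,3]}=c$. **Theorem.** (1) Suppose that $\pi_1(M,m_0)$ has no element of order two. Then choices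 of based curves $s$ exist, and for each of them: all sets $\Gamma(\alpha,\beta)$ are non-empty; for all $a,b,c$ as above an $\omega$ exists; the operations $m,P,Q$ are well defined on homotopy classes (for $m$: independent of $a,b,c$ in their classes and of $\omega$); and with them $\Gamma(M)=\{\Gamma(\alpha,\beta)\}$ is a $\Delta$-group based at $\pi_1(M,m_0)$. (2) Let $(M,m_0)$ and $(N,n_0)$ be two such spaces with choices of based curves $s$, $s'$, let $f:M\to N$ be continuous and $c$ a path from $f(m_0)$ to $n_0$ (constant if $f$ preserves base points; it always exists if $N$ is path connected). Let $f_*:\pi_1(M,m_0)\to\pi_1(N,n_0)$ be the homomorphism $[\gamma]\mapsto[\bar c\cdot(f\circ\gamma)\cdot c]$, where the concatenation is read from left to right and $\bar c$ is the reverse of $c$. Then there are families of homotopies $H_\alpha$, $\alpha\in\pi_1(M,m_0)$, from $f\circ s(\alpha)$ to $s'(f_*\alpha)$ whose two endpoints move along $c$ and with $H_{\alpha^{-1}}(u,t)=H_\alpha(u,1-t)$. For every such family, each $f\circ a$ with $[a]\in\Gamma(\alpha,\beta)$ is homotopic, through a homotopy that on the three edges is $H_\alpha$, $H_\beta$, $H_{\beta\alpha}$,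 to a map $b$ representing an element of $\Gamma(f_*\alpha,f_*\beta)$; the class $[b]$ depends only on $[a]$; and $f^*:[a]\mapsto[b]$ is a morphism of $\Delta$-groups $\Gamma(M)\to\Gamma(N)$ over $f_*$. -/

import Mathlib

open scoped unitInterval

/-! ### Δ-groups -/

/-- Transport of an element of `T g h` along equalities of the two indices. -/
def reindex {G : Type*} {T : G → G → Type*} {g h g' h' : G} (hg : g = g') (hh : h = h')
    (x : T g h) : T g' h' :=
  cast (congrArg₂ T hg hh) x

/-- The structure of a Δ-group based at the group `G` on a family of sets `T g h`, `g h : G`.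
The occurrences of `reindex` only identify `T g h` with `T g' h'` when `g = g'` and `h = h'`
hold in `G`. -/
structure DeltaGroup (G : Type*) [Group G] (T : G → G → Type*) where
  m : ∀ g h k : G, T g h⁻¹ → T h k⁻¹ → T (h⁻¹ * g) (k⁻¹ * h) → T g k⁻¹
  P : ∀ {g h : G}, T g h → T h (g⁻¹ * h⁻¹)
  Q : ∀ {g h : G}, T g h → T g⁻¹ (h * g)
  /-- `P³ = id` -/
  P_P_P : ∀ {g h : G} (a : T g h),
    reindex (by group) (by group) (P (P (P a))) = a
  /-- `Q² = id` -/
  Q_Q : ∀ {g h : G} (a : T g h),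
    reindex (by group) (by group) (Q (Q a)) = a
  /-- `P² Q = Q P` -/
  P_P_Q : ∀ {g h : G} (a : T g h),
    reindex (by group) (by group) (P (P (Q a))) = Q (P a)
  /-- `P (m (a, b, c)) = m (P b, P c, P a)` -/
  P_m : ∀ (g h k : G) (a : T g h⁻¹) (b : T h k⁻¹) (c : T (h⁻¹ * g) (k⁻¹ * h)),
    P (m g h k a b c) =
      reindex rfl (by group)
        (m k⁻¹ (k⁻¹ * h) (k⁻¹ * g)
          (reindex rfl (by group) (P b))
          (reindex rfl (by group) (P c))
          (reindex (by group) (by group) (P a)))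
  /-- `Q (m (a, b, c)) = m (Q a, Q c, Q b)` -/
  Q_m : ∀ (g h k : G) (a : T g h⁻¹) (b : T h k⁻¹) (c : T (h⁻¹ * g) (k⁻¹ * h)),
    Q (m g h k a b c) =
      reindex rfl (by group)
        (m g⁻¹ (g⁻¹ * h) (g⁻¹ * k)
          (reindex rfl (by group) (Q a))
          (reindex (by group) (by group) (Q c))
          (reindex (by group) (by group) (Q b)))
  /-- `m (m (a, b, c), d, e) = m (a, m (b, d, f), m (c, Q f, e))` -/
  m_m : ∀ (g h k l : G) (a : T g h⁻¹) (b : T h k⁻¹) (c : T (h⁻¹ * g) (k⁻¹ * h))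
    (d : T k l⁻¹) (e : T (k⁻¹ * g) (l⁻¹ * k)) (f : T (k⁻¹ * h) (l⁻¹ * k)),
    m g k l (m g h k a b c) d e =
      m g h l a (m h k l b d f)
        (reindex rfl (by group)
          (m (h⁻¹ * g) (h⁻¹ * k) (h⁻¹ * l)
            (reindex rfl (by group) c)
            (reindex (by group) (by group) (Q f))
            (reindex (by group) (by group) e)))
  /-- `m (m (f, a, b), P² Q a, P Q b) = f` -/
  m_inv : ∀ (g h k : G) (f : T g h⁻¹) (a : T h k⁻¹) (b : T (h⁻¹ * g) (k⁻¹ * h)),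
    m g k h (m g h k f a b)
      (reindex (by group) (by group) (P (P (Q a))))
      (reindex (by group) (by group) (P (Q b))) = f

/-- A morphism of Δ-groups over a homomorphism `φ` of the base groups: a family of maps
`T g h → T' (φ g) (φ h)` compatible with `m`, `P` and `Q`. -/
structure DeltaGroup.Hom {G G' : Type*} [Group G] [Group G'] {T : G → G → Type*}
    {T' : G' → G' → Type*} (φ : G →* G') (D : DeltaGroup G T) (D' : DeltaGroup G' T') where
  map : ∀ {g h : G}, T g h → T' (φ g) (φ h)
  map_P : ∀ {g h : G} (a : T g h),
    reindex rfl (by simp) (map (D.P a)) = D'.P (map a)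
  map_Q : ∀ {g h : G} (a : T g h),
    reindex (by simp) (by simp) (map (D.Q a)) = D'.Q (map a)
  map_m : ∀ (g h k : G) (a : T g h⁻¹) (b : T h k⁻¹) (c : T (h⁻¹ * g) (k⁻¹ * h)),
    reindex rfl (by simp) (map (D.m g h k a b c)) =
      D'.m (φ g) (φ h) (φ k)
        (reindex rfl (by simp) (map a))
        (reindex rfl (by simp) (map b))
        (reindex (by simp) (by simp) (map c))

/-! ### Simplices -/

/-- The edge of the standard simplex running from the vertex `i` (at `t = 0`) to the vertex `j`
(at `t = 1`), that is `t ↦ (1 - t) eᵢ + t eⱼ`. -/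
noncomputable def simplexEdge {n : ℕ} (i j : Fin n) (t : I) : stdSimplex ℝ (Fin n) :=
  stdSimplex.map ![i, j] (stdSimplexHomeomorphUnitInterval.symm t)

theorem map_simplexEdge {n k : ℕ} (f : Fin n → Fin k) (i j : Fin n) (t : I) :
    stdSimplex.map f (simplexEdge i j t) = simplexEdge (f i) (f j) t := by
  unfold simplexEdge
  rw [stdSimplex.map_comp_apply]
  congr 1
  funext x
  fin_cases x <;> rfl

theorem simplexEdge_symm {n : ℕ} (i j : Fin n) (t : I) :
    simplexEdge j i t = simplexEdge i j (σ t) := by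
  have h : stdSimplexHomeomorphUnitInterval.symm (σ t) =
      stdSimplex.map ![1, 0] (stdSimplexHomeomorphUnitInterval.symm t) := by
    apply stdSimplex.ext
    funext x
    have h0 (u : I) : stdSimplexHomeomorphUnitInterval.symm u 0 = 1 - (u : ℝ) := rfl
    have h1 (u : I) : stdSimplexHomeomorphUnitInterval.symm u 1 = (u : ℝ) := rfl
    rw [stdSimplex.map_coe, FunOnFinite.linearMap_apply_apply]
    fin_cases x
    · simp [Finset.sum_filter, Fin.sum_univ_two, h0, h1]
    · simp [Finset.sum_filter, Fin.sum_univ_two, h0, h1]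
  unfold simplexEdge
  rw [h, stdSimplex.map_comp_apply]
  congr 1
  funext x
  fin_cases x <;> rfl

/-- The affine map of standard simplices that sends the vertex `i` to the vertex `f i`, as a
continuous map. -/
noncomputable def simplexMap {n k : ℕ} (f : Fin n → Fin k) :
    C(stdSimplex ℝ (Fin n), stdSimplex ℝ (Fin k)) :=
  ⟨stdSimplex.map f, stdSimplex.continuous_map f⟩

theorem simplexMap_edge {n k : ℕ} (f : Fin n → Fin k) (i j : Fin n) (t : I) :
    simplexMap f (simplexEdge i j t) = simplexEdge (f i) (f j) t :=
  map_simplexEdge f i j t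

/-- The boundary of the standard simplex. -/
def simplexBoundary (n : ℕ) : Set (stdSimplex ℝ (Fin n)) :=
  {x | ∃ i, x i = 0}

/-! ### The construction of `Γ(M)` -/

/-- A choice of based curves: a section `s` of `Ω(M, m₀) → π₁(M, m₀)` such that `s (α⁻¹)` is the
reversed path of `s α` and `s 1` is the constant path. -/
structure LoopSection (M : Type*) [TopologicalSpace M] (m₀ : M) where
  loop : FundamentalGroup M m₀ → Path m₀ m₀
  mk_loop : ∀ α, FundamentalGroup.fromPath (Path.Homotopic.Quotient.mk (loop α)) = α
  loop_inv : ∀ α, loop α⁻¹ = (loop α).symm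
  loop_one : loop 1 = Path.refl m₀

/-- The maps `a : Δ₂ → M` whose restrictions to the three edges are the based curves of
`α`, `β` and `β α`. The product `β α` of the fundamental group is the class of the path "first `α`,
then `β`"; accordingly `α` is read from the vertex `0` to the vertex `1`, `β` from `1` to `2` and
`β α` from `0` to `2`. -/
structure TwoSimplex {M : Type*} [TopologicalSpace M] {m₀ : M} (s : LoopSection M m₀)
    (α β : FundamentalGroup M m₀) where
  toMap : C(stdSimplex ℝ (Fin 3), M)
  edge01 : ∀ t, toMap (simplexEdge 0 1 t) = s.loop α t
  edge12 : ∀ t, toMap (simplexEdge 1 2 t) = s.loop β t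
  edge02 : ∀ t, toMap (simplexEdge 0 2 t) = s.loop (β * α) t

namespace TwoSimplex

variable {M : Type*} [TopologicalSpace M] {m₀ : M} {s : LoopSection M m₀}
  {α β : FundamentalGroup M m₀}

/-- Homotopy of 2-simplices with fixed boundary curves. -/
instance setoid (s : LoopSection M m₀) (α β : FundamentalGroup M m₀) :
    Setoid (TwoSimplex s α β) where
  r a b := a.toMap.HomotopicRel b.toMap (simplexBoundary 3)
  iseqv := ⟨fun _ => .refl _, fun h => h.symm, fun h h' => h.trans h'⟩

/-- `a ↦ a ∘ p`, where `p` sends the vertices `0, 1, 2` to `1, 2, 0`,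
that is `p (x₀, x₁, x₂) = (x₂, x₀, x₁)`. -/
noncomputable def rot (a : TwoSimplex s α β) : TwoSimplex s β (α⁻¹ * β⁻¹) where
  toMap := a.toMap.comp (simplexMap ![1, 2, 0])
  edge01 t := by
    rw [ContinuousMap.comp_apply, simplexMap_edge]
    exact a.edge12 t
  edge12 t := by
    rw [ContinuousMap.comp_apply, simplexMap_edge, ← mul_inv_rev, s.loop_inv, Path.symm_apply,
      Function.comp_apply, ← a.edge02, ← simplexEdge_symm]
    rfl
  edge02 t := by
    rw [ContinuousMap.comp_apply, simplexMap_edge, inv_mul_cancel_right, s.loop_inv,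
      Path.symm_apply, Function.comp_apply, ← a.edge01, ← simplexEdge_symm]
    rfl

/-- `a ↦ a ∘ q`, where `q` exchanges the vertices `0` and `1`,
that is `q (x₀, x₁, x₂) = (x₁, x₀, x₂)`. -/
noncomputable def flip (a : TwoSimplex s α β) : TwoSimplex s α⁻¹ (β * α) where
  toMap := a.toMap.comp (simplexMap ![1, 0, 2])
  edge01 t := by
    rw [ContinuousMap.comp_apply, simplexMap_edge, s.loop_inv, Path.symm_apply,
      Function.comp_apply, ← a.edge01, ← simplexEdge_symm]
    rfl
  edge12 t := by
    rw [ContinuousMap.comp_apply, simplexMap_edge]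
    exact a.edge02 t
  edge02 t := by
    rw [ContinuousMap.comp_apply, simplexMap_edge, mul_inv_cancel_right]
    exact a.edge12 t

/-- There is a map `ω : Δ₃ → M` whose restrictions to the faces `[1,2,0]`, `[0,2,3]`, `[1,0,3]`
and `[1,2,3]` are `a`, `b`, `c` and `d`. -/
def Glues {γ : FundamentalGroup M m₀} (a : TwoSimplex s α β⁻¹) (b : TwoSimplex s β γ⁻¹)
    (c : TwoSimplex s (β⁻¹ * α) (γ⁻¹ * β)) (d : TwoSimplex s α γ⁻¹) : Prop :=
  ∃ ω : C(stdSimplex ℝ (Fin 4), M),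
    ω.comp (simplexMap ![1, 2, 0]) = a.toMap ∧
    ω.comp (simplexMap ![0, 2, 3]) = b.toMap ∧
    ω.comp (simplexMap ![1, 0, 3]) = c.toMap ∧
    ω.comp (simplexMap ![1, 2, 3]) = d.toMap

end TwoSimplex

/-- `Γ(α, β)`: homotopy classes, relative to the boundary, of 2-simplices with boundary curves
`α`, `β`, `β α`. -/
def Gam {M : Type*} [TopologicalSpace M] {m₀ : M} (s : LoopSection M m₀)
    (α β : FundamentalGroup M m₀) : Type _ :=
  Quotient (TwoSimplex.setoid s α β)

/-- The class in `Γ(α, β)` of a 2-simplex. -/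
def TwoSimplex.cls {M : Type*} [TopologicalSpace M] {m₀ : M} {s : LoopSection M m₀}
    {α β : FundamentalGroup M m₀} (a : TwoSimplex s α β) : Gam s α β :=
  Quotient.mk _ a

/-- The operations of the Δ-group `D` on the sets `Γ(α, β)` are the geometric ones:
`P [a] = [a ∘ p]`, `Q [a] = [a ∘ q]`, and `m ([a], [b], [c])` is the class of the fourth face of
any 3-simplex that has `a`, `b`, `c` as its other faces. -/
structure IsGamma {M : Type*} [TopologicalSpace M] {m₀ : M} (s : LoopSection M m₀)
    (D : DeltaGroup (FundamentalGroup M m₀) (Gam s)) : Prop where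
  P_cls : ∀ {α β : FundamentalGroup M m₀} (a : TwoSimplex s α β), D.P a.cls = a.rot.cls
  Q_cls : ∀ {α β : FundamentalGroup M m₀} (a : TwoSimplex s α β), D.Q a.cls = a.flip.cls
  exists_glues : ∀ {α β γ : FundamentalGroup M m₀} (a : TwoSimplex s α β⁻¹)
    (b : TwoSimplex s β γ⁻¹) (c : TwoSimplex s (β⁻¹ * α) (γ⁻¹ * β)),
    ∃ d : TwoSimplex s α γ⁻¹, TwoSimplex.Glues a b c d
  m_cls : ∀ {α β γ : FundamentalGroup M m₀} (a : TwoSimplex s α β⁻¹)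
    (b : TwoSimplex s β γ⁻¹) (c : TwoSimplex s (β⁻¹ * α) (γ⁻¹ * β)) (d : TwoSimplex s α γ⁻¹),
    TwoSimplex.Glues a b c d → D.m α β γ a.cls b.cls c.cls = d.cls

/-! ### The map induced by a continuous map -/

section Induced

variable {M N : Type*} [TopologicalSpace M] [TopologicalSpace N] {m₀ : M} {n₀ : N}

/-- The homomorphism `π₁(M, m₀) → π₁(N, n₀)` induced by `f : M → N` and a path `c` from `f m₀` to
`n₀`; if `f m₀ = n₀` and `c` is constant this is the usual `π₁(f)`. -/
noncomputable def inducedHom (f : C(M, N)) (c : Path (f m₀) n₀) :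
    FundamentalGroup M m₀ →* FundamentalGroup N n₀ :=
  (FundamentalGroup.fundamentalGroupMulEquivOfPath c).toMonoidHom.comp (FundamentalGroup.map f m₀)

/-- A choice of homotopies from the curves `f ∘ s(α)` to the based curves `s'(f_* α)`, whose
endpoints move along `c`, and which is compatible with the reversal of curves. -/
structure EdgeHomotopies (s : LoopSection M m₀) (s' : LoopSection N n₀) (f : C(M, N))
    (c : Path (f m₀) n₀) where
  H : FundamentalGroup M m₀ → C(I × I, N)
  at_zero : ∀ α t, H α (0, t) = f (s.loop α t)
  at_one : ∀ α t, H α (1, t) = s'.loop (inducedHom f c α) t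
  source : ∀ α u, H α (u, 0) = c u
  target : ∀ α u, H α (u, 1) = c u
  inv : ∀ α u t, H α⁻¹ (u, t) = H α (u, σ t)

/-- There is a homotopy from `f ∘ a` to `b` that restricts to the chosen homotopies on the three
edges of the simplex. -/
def EdgeHomotopies.Carries {s : LoopSection M m₀} {s' : LoopSection N n₀} {f : C(M, N)}
    {c : Path (f m₀) n₀} (E : EdgeHomotopies s s' f c) {α β : FundamentalGroup M m₀}
    (a : TwoSimplex s α β) (b : TwoSimplex s' (inducedHom f c α) (inducedHom f c β)) : Prop :=
  ∃ K : (f.comp a.toMap).Homotopy b.toMap, ∀ u t,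
    K (u, simplexEdge 0 1 t) = E.H α (u, t) ∧
    K (u, simplexEdge 1 2 t) = E.H β (u, t) ∧
    K (u, simplexEdge 0 2 t) = E.H (β * α) (u, t)

/-- `F` is the map `Γ(M) → Γ(N)` induced by `f` through the chosen homotopies of curves:
it sends `[a]` to the class of any `b` obtained from `f ∘ a` by a homotopy that extends the chosen
ones on the edges. -/
structure IsInduced {s : LoopSection M m₀} {s' : LoopSection N n₀} {f : C(M, N)}
    {c : Path (f m₀) n₀} (E : EdgeHomotopies s s' f c)
    {D : DeltaGroup (FundamentalGroup M m₀) (Gam s)}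
    {D' : DeltaGroup (FundamentalGroup N n₀) (Gam s')}
    (F : DeltaGroup.Hom (inducedHom f c) D D') : Prop where
  exists_carries : ∀ {α β : FundamentalGroup M m₀} (a : TwoSimplex s α β),
    ∃ b : TwoSimplex s' (inducedHom f c α) (inducedHom f c β), E.Carries a b
  map_cls : ∀ {α β : FundamentalGroup M m₀} (a : TwoSimplex s α β)
    (b : TwoSimplex s' (inducedHom f c α) (inducedHom f c β)),
    E.Carries a b → F.map a.cls = b.cls

end Induced

/-! ### Extension of maps over retracts -/

section Extension

variable {X Y Z M : Type*} [TopologicalSpace X] [TopologicalSpace Y] [TopologicalSpace Z]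
  [TopologicalSpace M]

/-! Everything rests on two extension principles for simplices. A simplex retracts to each of its
horns, and a prism over a simplex retracts to its bottom together with its sides, over either a horn
or the whole boundary. Compatible maps on the facets of a horn therefore have a filler, and
homotopies given on the sides extend. Segments in the simplex or prism also deform it to the
retract, so two fillers are homotopic relative to the retract. Existence and uniqueness up to
homotopy come from this pair of facts.

The faces `a`, `b`, `c` in the definition of `m` are the facets of a tetrahedron that contain the
vertex 0. A filler of this horn supplies the fourth face (`TwoSimplex.exists_glues`), and uniqueness
of fillers, with homotopies of the facets glued over the horn, shows that its class is well defined
(`TwoSimplex.Glues.cls_eq`). The laws for `P`, `Q` and inversion follow by permuting the vertices of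
one tetrahedron. Associativity comes from a 4-simplex: the four tetrahedra for the inner and outer
products form its horn at the vertex 3, and the remaining facet of a filler displays the right-hand
side (`TwoSimplex.Glues.assoc`).

For the induced morphism the prescribed homotopies on the edges are extended over the prism. One
further parameter shows that the class of the top depends only on that of the bottom
(`EdgeHomotopies.Carries.cls_eq`). Extending over the prism above a tetrahedron carries gluings to
gluings (`EdgeHomotopies.Carries.exists_glues`).

Elements of order two are excluded because curves must be reversed compatibly with inversion: a loop
equal to its own reverse retraces its first half and is null-homotopic. Without such elements one
chooses on one member of each inverse pair and reverses for the other (`exists_choice_inv`). -/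

/-- A map on a compact space `Y` that is constant on the fibres of `p : Y → X` extends to `X`
if `X` retracts to the range of `p`. -/
theorem exists_extension_of_retraction [CompactSpace Y] [T2Space X] (p : C(Y, X)) (F : C(Y, M))
    (hF : ∀ y y', p y = p y' → F y = F y') (r : C(X, X)) (hr : ∀ x, r x ∈ Set.range p)
    (hrp : ∀ y, r (p y) = p y) : ∃ G : C(X, M), ∀ y, G (p y) = F y := by
  let p' : C(Y, Set.range p) := ⟨Set.rangeFactorization p, by fun_prop⟩
  -- A continuous surjection from a compact space to a Hausdorff space is a quotient map, so `F`
  -- descends to the range of `p`; the retraction then extends it.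
  have hp' : Topology.IsQuotientMap p' :=
    .of_surjective_continuous Set.rangeFactorization_surjective p'.continuous
  have hF' : ∀ a b, p' a = p' b → F a = F b := fun a b h => hF a b (congrArg Subtype.val h)
  let L : C(Set.range p, M) := hp'.lift F hF'
  have hL : ∀ y, L (p' y) = F y := fun y => congrArg (fun f : C(Y, M) => f y) (hp'.lift_comp F hF')
  refine ⟨L.comp ⟨fun x => ⟨r x, hr x⟩, by fun_prop⟩, fun y => ?_⟩
  rw [← hL y]
  exact congrArg L (Subtype.ext (hrp y))

/-- Precomposition of a relative homotopy with a map of pairs. -/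
theorem ContinuousMap.HomotopicRel.precomp {f g : C(X, M)} {S : Set X} {T : Set Y}
    (h : f.HomotopicRel g S) (φ : C(Y, X)) (hφ : Set.MapsTo φ T S) :
    (f.comp φ).HomotopicRel (g.comp φ) T := by
  obtain ⟨H⟩ := h
  exact ⟨{ toHomotopy := H.toHomotopy.compContinuousMap φ
           prop' := fun t x hx => H.prop t (φ x) (hφ hx) }⟩

/-- Two maps that agree on a retract `A` are homotopic relative to `A` if the ambient space has a
continuous choice of segments. -/
theorem homotopicRel_of_eqOn_retract (L : C(I × (X × X), X)) (hL₀ : ∀ x y, L (0, x, y) = x)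
    (hL₁ : ∀ x y, L (1, x, y) = y) (hL : ∀ t x, L (t, x, x) = x) {A : Set X} (r : C(X, X))
    (hr : ∀ x, r x ∈ A) (hrA : ∀ x ∈ A, r x = x) {f g : C(X, M)} (hfg : Set.EqOn f g A) :
    f.HomotopicRel g A := by
  -- Slide `x` to `r x` along the chosen segment; points of `A` do not move. Both maps are thus
  -- deformed to their composites with `r`, which coincide.
  have key (f : C(X, M)) : f.HomotopicRel (f.comp r) A :=
    ⟨{ toFun := fun p => f (L (p.1, p.2, r p.2))
       continuous_toFun := by fun_prop
       map_zero_left := fun x => by simp [hL₀]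
       map_one_left := fun x => by simp [hL₁]
       prop' := fun t x hx => by
        change f (L (t, x, r x)) = f x
        rw [hrA x hx, hL] }⟩
  have : f.comp r = g.comp r := by
    ext x
    exact hfg (hr x)
  exact (key f).trans (this ▸ (key g).symm)

/-- Extension of a map, depending on a parameter `z`, from a retract that is covered by the images
of finitely many compact pieces. -/
theorem exists_extension_of_pieces {ι : Type*} [Finite ι] [CompactSpace Y] [CompactSpace Z]
    [T2Space X] [T2Space Z] (q : ι → C(Y, X)) (r : C(X, X)) (hr : ∀ x, ∃ i y, r x = q i y)
    (hrq : ∀ i y, r (q i y) = q i y) (F : ι → C(Z × Y, M))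
    (hF : ∀ i j x y z, q i x = q j y → F i (z, x) = F j (z, y)) :
    ∃ G : C(Z × X, M), ∀ i z y, G (z, q i y) = F i (z, y) := by
  -- With `ι` discrete, `ι × (Z × Y)` is a finite disjoint union of compact pieces, so the
  -- single-map version applies.
  let _ : TopologicalSpace ι := ⊥
  have : DiscreteTopology ι := ⟨rfl⟩
  let p : C(ι × (Z × Y), Z × X) := ⟨fun w => (w.2.1, q w.1 w.2.2), by
    rw [continuous_prod_of_discrete_left]
    intro i
    fun_prop⟩
  let F' : C(ι × (Z × Y), M) := ⟨fun w => F w.1 w.2, by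
    rw [continuous_prod_of_discrete_left]
    exact fun i => (F i).continuous⟩
  obtain ⟨G, hG⟩ := exists_extension_of_retraction p F' (by
      rintro ⟨i, z, x⟩ ⟨j, z', y⟩ h
      obtain ⟨rfl, h⟩ := Prod.mk.inj h
      exact hF i j x y z h)
    ((ContinuousMap.id Z).prodMap r) (by
      rintro ⟨z, x⟩
      obtain ⟨i, y, h⟩ := hr x
      exact ⟨(i, z, y), Prod.ext rfl h.symm⟩)
    (by
      rintro ⟨i, z, y⟩
      exact Prod.ext rfl (hrq i y))
  exact ⟨G, fun i z y => hG (i, z, y)⟩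

/-- `R` retracts `I × X` to `{0} × X ∪ I × A`. -/
structure IsBoxRetraction (A : Set X) (R : C(I × X, I × X)) : Prop where
  bottom : ∀ x, R (0, x) = (0, x)
  side : ∀ u, ∀ x ∈ A, R (u, x) = (u, x)
  mem : ∀ u x, (R (u, x)).1 = 0 ∨ (R (u, x)).2 ∈ A

/-- The homotopy extension property, with a parameter `z`, for a subspace that is covered by the
images of finitely many compact pieces. -/
theorem IsBoxRetraction.exists_extension {A : Set X} {R : C(I × X, I × X)}
    (hR : IsBoxRetraction A R) {ι : Type*} [Finite ι] [CompactSpace Y] [CompactSpace Z]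
    [CompactSpace X] [T2Space X] [T2Space Z] (q : ι → C(Y, X)) (hqA : ∀ i y, q i y ∈ A)
    (hq : ∀ x ∈ A, ∃ i y, q i y = x) (g : C(Z × X, M)) (F : ι → C(Z × (I × Y), M))
    (hF : ∀ i j x y z u, q i x = q j y → F i (z, u, x) = F j (z, u, y))
    (hgF : ∀ i z y, F i (z, 0, y) = g (z, q i y)) :
    ∃ G : C(Z × (I × X), M), (∀ z x, G (z, 0, x) = g (z, x)) ∧
      ∀ i z u y, G (z, u, q i y) = F i (z, u, y) := by
  let _ : TopologicalSpace ι := ⊥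
  have : DiscreteTopology ι := ⟨rfl⟩
  -- The pieces are the bottom of the prism and the side over each `q i`; their images together make
  -- up the retract.
  let p : C((Z × X) ⊕ ι × (Z × (I × Y)), Z × (I × X)) :=
    ⟨Sum.elim (fun w => (w.1, 0, w.2)) (fun w => (w.2.1, w.2.2.1, q w.1 w.2.2.2)), by
      refine continuous_sumElim.2 ⟨by fun_prop, ?_⟩
      rw [continuous_prod_of_discrete_left]
      intro i
      fun_prop⟩
  let F' : C((Z × X) ⊕ ι × (Z × (I × Y)), M) :=
    ⟨Sum.elim g (fun w => F w.1 w.2), by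
      refine continuous_sumElim.2 ⟨by fun_prop, ?_⟩
      rw [continuous_prod_of_discrete_left]
      exact fun i => (F i).continuous⟩
  obtain ⟨G, hG⟩ := exists_extension_of_retraction p F' (by
      rintro (⟨z, x⟩ | ⟨i, z, u, y⟩) (⟨z', x'⟩ | ⟨i', z', u', y'⟩) h <;>
        obtain ⟨rfl, h'⟩ := Prod.mk.inj h <;> obtain ⟨h₁, h₂⟩ := Prod.mk.inj h'
      · exact congrArg (fun x => g (z, x)) h₂
      · change 0 = u' at h₁
        change x = q i' y' at h₂
        subst h₁ h₂
        exact (hgF i' z y').symm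
      · change u = 0 at h₁
        change q i y = x' at h₂
        subst h₁ h₂
        exact hgF i z y
      · change u = u' at h₁
        subst h₁
        exact hF i i' y y' z u h₂)
    ((ContinuousMap.id Z).prodMap R) (by
      rintro ⟨z, u, x⟩
      rcases hR.mem u x with h | h
      · exact ⟨.inl (z, (R (u, x)).2), Prod.ext rfl (Prod.ext h.symm rfl)⟩
      · obtain ⟨i, y, h⟩ := hq _ h
        exact ⟨.inr (i, z, (R (u, x)).1, y), Prod.ext rfl (Prod.ext rfl h)⟩)
    (by
      rintro (⟨z, x⟩ | ⟨i, z, u, y⟩)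
      · exact Prod.ext rfl (hR.bottom x)
      · exact Prod.ext rfl (hR.side u _ (hqA i y)))
  exact ⟨G, fun z x => hG (.inl (z, x)), fun i z u y => hG (.inr (i, z, u, y))⟩

end Extension

/-! ### Geometry of the standard simplex -/

theorem simplexMap_apply_of_injective {n k : ℕ} {f : Fin n → Fin k} (hf : f.Injective)
    (x : stdSimplex ℝ (Fin n)) (i : Fin n) : simplexMap f x (f i) = x i := by
  change stdSimplex.map f x (f i) = x i
  rw [stdSimplex.map_coe, FunOnFinite.linearMap_apply_apply,
    Finset.sum_eq_single i (fun j hj hji => absurd (hf (by simpa using hj)) hji) (by simp)]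

theorem simplexMap_apply_of_notMem {n k : ℕ} {f : Fin n → Fin k}
    (x : stdSimplex ℝ (Fin n)) {j : Fin k} (hj : j ∉ Set.range f) : simplexMap f x j = 0 := by
  change stdSimplex.map f x j = 0
  rw [stdSimplex.map_coe, FunOnFinite.linearMap_apply_apply]
  exact Finset.sum_eq_zero fun i hi => absurd ⟨i, by simpa using hi⟩ hj

theorem simplexMap_injective {n k : ℕ} {f : Fin n → Fin k} (hf : f.Injective) :
    Function.Injective (simplexMap f) := by
  intro x y h
  apply stdSimplex.ext
  funext i
  rw [← simplexMap_apply_of_injective hf x, h, simplexMap_apply_of_injective hf]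

theorem simplexMap_simplexMap {n k l : ℕ} (f : Fin n → Fin k) (g : Fin k → Fin l)
    (x : stdSimplex ℝ (Fin n)) : simplexMap g (simplexMap f x) = simplexMap (g ∘ f) x :=
  stdSimplex.map_comp_apply f g x

theorem simplexMap_comp {n k l : ℕ} (f : Fin n → Fin k) (g : Fin k → Fin l) :
    (simplexMap g).comp (simplexMap f) = simplexMap (g ∘ f) :=
  ContinuousMap.ext (simplexMap_simplexMap f g)

/-- A point whose coordinates off the range of `f` vanish lies on the corresponding face. -/
theorem exists_simplexMap_eq {n k : ℕ} {f : Fin n → Fin k} (hf : f.Injective)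
    (x : stdSimplex ℝ (Fin k)) (hx : ∀ j ∉ Set.range f, x j = 0) : ∃ z, simplexMap f z = x := by
  have hsum : ∑ i, x (f i) = 1 := by
    rw [← stdSimplex.sum_eq_one x]
    exact Fintype.sum_of_injective f hf (fun i => x (f i)) x hx (fun _ => rfl)
  let z : stdSimplex ℝ (Fin n) := ⟨fun i => x (f i), fun i => stdSimplex.zero_le x _, hsum⟩
  refine ⟨z, stdSimplex.ext (funext fun j => ?_)⟩
  by_cases hj : j ∈ Set.range f
  · obtain ⟨i, rfl⟩ := hj
    exact simplexMap_apply_of_injective hf z i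
  · rw [hx j hj, simplexMap_apply_of_notMem z hj]

/-- The intersection of two faces of a simplex is a common face. -/
theorem exists_of_simplexMap_eq {n k l m : ℕ} {f : Fin n → Fin m} {g : Fin k → Fin m}
    {θ : Fin l → Fin n} {θ' : Fin l → Fin k} (hf : f.Injective) (hg : g.Injective)
    (hθ : θ.Injective) (hfg : f ∘ θ = g ∘ θ') (h : ∀ i j, f i = g j → i ∈ Set.range θ)
    {x : stdSimplex ℝ (Fin n)} {y : stdSimplex ℝ (Fin k)} (hxy : simplexMap f x = simplexMap g y) :
    ∃ z, simplexMap θ z = x ∧ simplexMap θ' z = y := by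
  obtain ⟨z, rfl⟩ := exists_simplexMap_eq hθ x fun i hi => by
    rw [← simplexMap_apply_of_injective hf, hxy]
    refine simplexMap_apply_of_notMem y ?_
    rintro ⟨j, hj⟩
    exact hi (h i j hj.symm)
  refine ⟨z, rfl, simplexMap_injective hg ?_⟩
  rw [← hxy, simplexMap_simplexMap, simplexMap_simplexMap, hfg]

theorem stdSimplex_eval_continuous {n : ℕ} (i : Fin n) :
    Continuous fun x : stdSimplex ℝ (Fin n) => x i :=
  (continuous_apply i).comp continuous_subtype_val

/-- The segment between two points of a simplex. -/
noncomputable def simplexSegment (n : ℕ) :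
    C(I × (stdSimplex ℝ (Fin n) × stdSimplex ℝ (Fin n)), stdSimplex ℝ (Fin n)) where
  toFun p := ⟨(1 - p.1 : ℝ) • p.2.1.1 + (p.1 : ℝ) • p.2.2.1,
    convex_stdSimplex ℝ _ p.2.1.2 p.2.2.2 (sub_nonneg.2 p.1.2.2) p.1.2.1 (sub_add_cancel _ _)⟩
  continuous_toFun := by fun_prop

theorem simplexSegment_zero {n : ℕ} (x y : stdSimplex ℝ (Fin n)) :
    simplexSegment n (0, x, y) = x := by
  apply Subtype.ext
  simp [simplexSegment]

theorem simplexSegment_one {n : ℕ} (x y : stdSimplex ℝ (Fin n)) :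
    simplexSegment n (1, x, y) = y := by
  apply Subtype.ext
  simp [simplexSegment]

theorem simplexSegment_self {n : ℕ} (t : I) (x : stdSimplex ℝ (Fin n)) :
    simplexSegment n (t, x, x) = x := by
  apply Subtype.ext
  simp [simplexSegment, ← add_smul]

/-- The segment between two points of the unit interval. -/
noncomputable def intervalSegment : C(I × (I × I), I) where
  toFun p := ⟨(1 - p.1 : ℝ) • p.2.1.1 + (p.1 : ℝ) • p.2.2.1,
    convex_Icc (0 : ℝ) 1 p.2.1.2 p.2.2.2 (sub_nonneg.2 p.1.2.2) p.1.2.1 (sub_add_cancel _ _)⟩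
  continuous_toFun := by fun_prop

/-- The segment between two points of a prism. -/
noncomputable def prismSegment (n : ℕ) :
    C(I × ((I × stdSimplex ℝ (Fin n)) × (I × stdSimplex ℝ (Fin n))), I × stdSimplex ℝ (Fin n)) where
  toFun p := (intervalSegment (p.1, p.2.1.1, p.2.2.1), simplexSegment n (p.1, p.2.1.2, p.2.2.2))

/-- Maps on a simplex that agree on a retract are homotopic relative to it. -/
theorem homotopicRel_simplex_of_eqOn {M : Type*} [TopologicalSpace M] {n : ℕ}
    {A : Set (stdSimplex ℝ (Fin n))} (r : C(stdSimplex ℝ (Fin n), stdSimplex ℝ (Fin n)))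
    (hr : ∀ x, r x ∈ A) (hrA : ∀ x ∈ A, r x = x) {f g : C(stdSimplex ℝ (Fin n), M)}
    (hfg : Set.EqOn f g A) : f.HomotopicRel g A :=
  homotopicRel_of_eqOn_retract (simplexSegment n) simplexSegment_zero simplexSegment_one
    simplexSegment_self r hr hrA hfg

/-- Maps on a prism over a simplex that agree on the bottom and on the sides are homotopic relative
to these. -/
theorem IsBoxRetraction.homotopicRel_of_eqOn {M : Type*} [TopologicalSpace M] {n : ℕ}
    {A : Set (stdSimplex ℝ (Fin n))} {R : C(I × stdSimplex ℝ (Fin n), I × stdSimplex ℝ (Fin n))}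
    (hR : IsBoxRetraction A R) {f g : C(I × stdSimplex ℝ (Fin n), M)}
    (hfg : Set.EqOn f g {p | p.1 = 0 ∨ p.2 ∈ A}) :
    f.HomotopicRel g {p | p.1 = 0 ∨ p.2 ∈ A} := by
  refine homotopicRel_of_eqOn_retract (prismSegment n) (fun x y => ?_) (fun x y => ?_)
    (fun t x => ?_) R (fun p => hR.mem p.1 p.2) ?_ hfg
  · refine Prod.ext (Subtype.ext ?_) (simplexSegment_zero _ _)
    simp [prismSegment, intervalSegment]
  · refine Prod.ext (Subtype.ext ?_) (simplexSegment_one _ _)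
    simp [prismSegment, intervalSegment]
  · refine Prod.ext (Subtype.ext ?_) (simplexSegment_self _ _)
    simp [prismSegment, intervalSegment]
    ring
  · rintro ⟨u, x⟩ (h | h)
    · change u = 0 at h
      rw [h, hR.bottom]
    · exact hR.side u x h

/-! ### Retractions to horns -/

/-- The horn of a simplex: the union of the facets that contain the vertex `k`. -/
def simplexHorn {n : ℕ} (k : Fin n) : Set (stdSimplex ℝ (Fin n)) :=
  {x | ∃ i, i ≠ k ∧ x i = 0}

section Horn

variable {n : ℕ} (k : Fin (n + 2))

/-- The smallest coordinate other than `x k`. -/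
noncomputable def hornDepth (x : stdSimplex ℝ (Fin (n + 2))) : ℝ :=
  Finset.univ.inf' Finset.univ_nonempty fun i : Fin (n + 1) => x (k.succAbove i)

theorem hornDepth_le (x : stdSimplex ℝ (Fin (n + 2))) {i : Fin (n + 2)} (hi : i ≠ k) :
    hornDepth k x ≤ x i := by
  obtain ⟨j, rfl⟩ := Fin.exists_succAbove_eq hi
  exact Finset.inf'_le _ (Finset.mem_univ j)

theorem hornDepth_nonneg (x : stdSimplex ℝ (Fin (n + 2))) : 0 ≤ hornDepth k x :=
  Finset.le_inf' _ _ fun _ _ => stdSimplex.zero_le x _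

theorem exists_hornDepth_eq (x : stdSimplex ℝ (Fin (n + 2))) :
    ∃ i, i ≠ k ∧ hornDepth k x = x i := by
  obtain ⟨j, -, hj⟩ := Finset.exists_mem_eq_inf' Finset.univ_nonempty
    fun i : Fin (n + 1) => x (k.succAbove i)
  exact ⟨_, Fin.succAbove_ne k j, hj⟩

theorem hornDepth_eq_zero {x : stdSimplex ℝ (Fin (n + 2))} (hx : x ∈ simplexHorn k) :
    hornDepth k x = 0 := by
  obtain ⟨i, hi, h⟩ := hx
  exact le_antisymm (h ▸ hornDepth_le k x hi) (hornDepth_nonneg k x)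

theorem continuous_hornDepth : Continuous (hornDepth k) :=
  Continuous.finset_inf'_apply _ fun _ _ => stdSimplex_eval_continuous _

/-- The amount by which a point of the prism is moved. -/
noncomputable def hornShift (p : I × stdSimplex ℝ (Fin (n + 2))) : ℝ :=
  min (p.1 : ℝ) (hornDepth k p.2)

theorem continuous_hornShift : Continuous (hornShift k) := by
  have := continuous_hornDepth k
  unfold hornShift
  fun_prop

theorem hornShift_nonneg (p : I × stdSimplex ℝ (Fin (n + 2))) : 0 ≤ hornShift k p :=
  le_min p.1.2.1 (hornDepth_nonneg k p.2)

/-- The retraction of a prism to its bottom and its sides over a horn, along the direction that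
lowers all coordinates but the `k`-th. -/
noncomputable def hornBoxRetraction :
    C(I × stdSimplex ℝ (Fin (n + 2)), I × stdSimplex ℝ (Fin (n + 2))) where
  toFun p :=
    (⟨p.1 - hornShift k p, sub_nonneg.2 (min_le_left _ _),
      (sub_le_self _ (hornShift_nonneg k p)).trans p.1.2.2⟩,
     ⟨fun i => p.2 i + hornShift k p * (if i = k then (n + 1 : ℝ) else -1), fun i => by
        beta_reduce
        split_ifs with h
        · have := hornShift_nonneg k p
          have := stdSimplex.zero_le p.2 i
          positivity
        · have : hornShift k p ≤ p.2 i := (min_le_right _ _).trans (hornDepth_le k p.2 h)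
          linarith, by
      -- The `k`-th coordinate gains exactly what the other `n + 1` coordinates lose.
      have h : ∑ i : Fin (n + 2), (if i = k then (n + 1 : ℝ) else -1) = 0 := by
        rw [Fin.sum_univ_succAbove _ k]
        simp
      rw [Finset.sum_add_distrib, ← Finset.mul_sum, h, stdSimplex.sum_eq_one, mul_zero, add_zero]⟩)
  continuous_toFun := by
    have h := continuous_hornShift k
    refine Continuous.prodMk (Continuous.subtype_mk (by fun_prop) _)
      (Continuous.subtype_mk (continuous_pi fun i => ?_) _)
    have := (stdSimplex_eval_continuous i).comp
      (continuous_snd : Continuous fun p : I × stdSimplex ℝ (Fin (n + 2)) => p.2)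
    exact this.add (h.mul continuous_const)

theorem hornBoxRetraction_eq_self {p : I × stdSimplex ℝ (Fin (n + 2))} (h : hornShift k p = 0) :
    hornBoxRetraction k p = p := by
  refine Prod.ext (Subtype.ext ?_) (stdSimplex.ext (funext fun i => ?_))
  · change (p.1 : ℝ) - hornShift k p = p.1
    rw [h, sub_zero]
  · change p.2 i + hornShift k p * _ = p.2 i
    rw [h, zero_mul, add_zero]

/-- When the height exceeds the depth, the shift is the depth itself, and the smallest coordinate
other than the `k`-th drops to 0. -/
theorem hornBoxRetraction_snd_mem {p : I × stdSimplex ℝ (Fin (n + 2))}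
    (h : hornDepth k p.2 ≤ p.1) : (hornBoxRetraction k p).2 ∈ simplexHorn k := by
  obtain ⟨i, hi, hx⟩ := exists_hornDepth_eq k p.2
  refine ⟨i, hi, ?_⟩
  change p.2 i + hornShift k p * (if i = k then (n + 1 : ℝ) else -1) = 0
  rw [if_neg hi, hornShift, min_eq_right h, hx]
  ring

/-- The shift is the largest that keeps the height and the lowered coordinates nonnegative. It
vanishes on the bottom and over the horn, and otherwise stops exactly on reaching one of them. -/
theorem isBoxRetraction_hornBoxRetraction :
    IsBoxRetraction (simplexHorn k) (hornBoxRetraction k) where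
  bottom x := hornBoxRetraction_eq_self k (min_eq_left (hornDepth_nonneg k x))
  side u x hx := hornBoxRetraction_eq_self k (by
    rw [hornShift, hornDepth_eq_zero k hx]
    exact min_eq_right u.2.1)
  mem u x := by
    rcases le_total (hornDepth k x) u with h | h
    · exact .inr (hornBoxRetraction_snd_mem k h)
    · refine .inl (Subtype.ext ?_)
      change (u : ℝ) - min (u : ℝ) (hornDepth k x) = 0
      rw [min_eq_left h, sub_self]

/-- The retraction of a simplex to a horn. -/
noncomputable def hornRetraction : C(stdSimplex ℝ (Fin (n + 2)), stdSimplex ℝ (Fin (n + 2))) where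
  toFun x := (hornBoxRetraction k (1, x)).2
  continuous_toFun := continuous_snd.comp ((hornBoxRetraction k).continuous.comp (by fun_prop))

theorem hornRetraction_mem (x : stdSimplex ℝ (Fin (n + 2))) :
    hornRetraction k x ∈ simplexHorn k := by
  apply hornBoxRetraction_snd_mem
  obtain ⟨i, -, h⟩ := exists_hornDepth_eq k x
  change hornDepth k x ≤ 1
  exact h ▸ stdSimplex.le_one x i

theorem hornRetraction_eq_self {x : stdSimplex ℝ (Fin (n + 2))} (hx : x ∈ simplexHorn k) :
    hornRetraction k x = x :=
  congrArg Prod.snd ((isBoxRetraction_hornBoxRetraction k).side 1 x hx)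

/-- Maps that agree on a horn are homotopic relative to the horn. -/
theorem homotopicRel_horn_of_eqOn {M : Type*} [TopologicalSpace M]
    {f g : C(stdSimplex ℝ (Fin (n + 2)), M)} (h : Set.EqOn f g (simplexHorn k)) :
    f.HomotopicRel g (simplexHorn k) :=
  homotopicRel_simplex_of_eqOn (hornRetraction k) (hornRetraction_mem k)
    (fun _ => hornRetraction_eq_self k) h

end Horn

/-! ### The retraction of a prism to its bottom and its sides -/

section Boundary

variable {n : ℕ}

/-- The smallest coordinate. -/
noncomputable def simplexDepth (x : stdSimplex ℝ (Fin (n + 1))) : ℝ :=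
  Finset.univ.inf' Finset.univ_nonempty x

/-- The inverse of the factor by which the point `(u, x)` is moved away from the axis over the
barycentre. -/
noncomputable def radialFactor (p : I × stdSimplex ℝ (Fin (n + 1))) : ℝ :=
  max (1 - (n + 1) * simplexDepth p.2) ((2 - p.1) / 2)

theorem simplexDepth_le (x : stdSimplex ℝ (Fin (n + 1))) (i : Fin (n + 1)) :
    simplexDepth x ≤ x i :=
  Finset.inf'_le _ (Finset.mem_univ i)

theorem simplexDepth_nonneg (x : stdSimplex ℝ (Fin (n + 1))) : 0 ≤ simplexDepth x :=
  Finset.le_inf' _ _ fun _ _ => stdSimplex.zero_le x _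

theorem exists_simplexDepth_eq (x : stdSimplex ℝ (Fin (n + 1))) : ∃ i, simplexDepth x = x i := by
  obtain ⟨j, -, hj⟩ := Finset.exists_mem_eq_inf' Finset.univ_nonempty x
  exact ⟨j, hj⟩

theorem continuous_radialFactor : Continuous (radialFactor (n := n)) := by
  have : Continuous (simplexDepth (n := n)) :=
    Continuous.finset_inf'_apply _ fun _ _ => stdSimplex_eval_continuous _
  unfold radialFactor
  fun_prop

theorem radialFactor_pos (p : I × stdSimplex ℝ (Fin (n + 1))) : 0 < radialFactor p :=
  lt_max_of_lt_right (by linarith [p.1.2.2])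

theorem radialFactor_le_one (p : I × stdSimplex ℝ (Fin (n + 1))) : radialFactor p ≤ 1 := by
  have h := simplexDepth_nonneg p.2
  exact max_le (sub_le_self _ (by positivity)) (by linarith [p.1.2.1])

/-- The retraction of a prism to its bottom and its sides, by projection from a point above the
centre of the top. -/
noncomputable def boxRetraction :
    C(I × stdSimplex ℝ (Fin (n + 1)), I × stdSimplex ℝ (Fin (n + 1))) where
  toFun p :=
    -- The centre of projection is the point at height 2 over the barycentre, and the displacement
    -- from it is divided by `radialFactor`.
    (⟨2 - (2 - p.1) / radialFactor p, by
      have h : (2 - (p.1 : ℝ)) / 2 ≤ radialFactor p := le_max_right _ _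
      rw [sub_nonneg, div_le_iff₀ (radialFactor_pos p)]
      linarith, by
      have h := radialFactor_le_one p
      rw [sub_le_comm, le_div_iff₀ (radialFactor_pos p)]
      linarith [p.1.2.2]⟩,
     ⟨fun i => 1 / (n + 1) + (p.2 i - 1 / (n + 1)) / radialFactor p, fun i => by
      have h : 1 - (n + 1) * simplexDepth p.2 ≤ radialFactor p := le_max_left _ _
      have h' := simplexDepth_le p.2 i
      have hn : (0 : ℝ) < n + 1 := by positivity
      have h₂ : (n + 1) * simplexDepth p.2 ≤ (n + 1) * p.2 i := by gcongr
      have hr := radialFactor_pos p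
      have : 1 / (n + 1 : ℝ) + (p.2 i - 1 / (n + 1)) / radialFactor p =
          (radialFactor p - (1 - (n + 1) * p.2 i)) / ((n + 1) * radialFactor p) := by
        field_simp
        ring
      beta_reduce
      rw [this]
      exact div_nonneg (by linarith) (by positivity), by
      have hn : (0 : ℝ) < n + 1 := by positivity
      have h : ∑ _i : Fin (n + 1), 1 / (n + 1 : ℝ) = 1 := by
        simp only [Finset.sum_const, Finset.card_univ, Fintype.card_fin, nsmul_eq_mul]
        push_cast
        field_simp
      rw [Finset.sum_add_distrib, ← Finset.sum_div (f := fun i => p.2 i - 1 / (n + 1 : ℝ)),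
        Finset.sum_sub_distrib, stdSimplex.sum_eq_one, h, sub_self, zero_div, add_zero]⟩)
  continuous_toFun := by
    have h := continuous_radialFactor (n := n)
    have h0 (p : I × stdSimplex ℝ (Fin (n + 1))) : radialFactor p ≠ 0 := (radialFactor_pos p).ne'
    refine Continuous.prodMk (Continuous.subtype_mk ?_ _)
      (Continuous.subtype_mk (continuous_pi fun i => ?_) _)
    · exact continuous_const.sub (Continuous.div (by fun_prop) h h0)
    · have := (stdSimplex_eval_continuous i).comp
        (continuous_snd : Continuous fun p : I × stdSimplex ℝ (Fin (n + 1)) => p.2)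
      exact continuous_const.add (Continuous.div (this.sub continuous_const) h h0)

theorem boxRetraction_eq_self {p : I × stdSimplex ℝ (Fin (n + 1))} (h : radialFactor p = 1) :
    boxRetraction p = p := by
  refine Prod.ext (Subtype.ext ?_) (stdSimplex.ext (funext fun i => ?_))
  · change 2 - (2 - (p.1 : ℝ)) / radialFactor p = p.1
    rw [h]
    ring
  · change 1 / (n + 1 : ℝ) + (p.2 i - 1 / (n + 1)) / radialFactor p = p.2 i
    rw [h]
    ring

/-- The two terms of the maximum defining `radialFactor` are the values at which the projecting ray
meets the side and the bottom; the larger one corresponds to the first hit. -/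
theorem isBoxRetraction_boxRetraction :
    IsBoxRetraction (simplexBoundary (n + 1)) boxRetraction where
  bottom x := boxRetraction_eq_self (le_antisymm (radialFactor_le_one _)
    (le_max_of_le_right (by simp)))
  side u x hx := by
    obtain ⟨i, hi⟩ := hx
    have h : simplexDepth x = 0 := le_antisymm (hi ▸ simplexDepth_le x i) (simplexDepth_nonneg x)
    exact boxRetraction_eq_self (le_antisymm (radialFactor_le_one _)
      (le_max_of_le_left (by simp [h])))
  mem u x := by
    have hr := radialFactor_pos (u, x)
    rcases le_total (1 - (n + 1) * simplexDepth x) ((2 - u) / 2 : ℝ) with h | h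
    · refine .inl (Subtype.ext ?_)
      have h' : radialFactor (u, x) = (2 - u) / 2 := max_eq_right h
      change 2 - (2 - (u : ℝ)) / radialFactor (u, x) = 0
      rw [sub_eq_zero, eq_div_iff hr.ne', h']
      ring
    · right
      obtain ⟨i, hi⟩ := exists_simplexDepth_eq x
      refine ⟨i, ?_⟩
      have h' : radialFactor (u, x) = 1 - (n + 1) * simplexDepth x := max_eq_left h
      change 1 / (n + 1 : ℝ) + (x i - 1 / (n + 1)) / radialFactor (u, x) = 0
      have hn : (0 : ℝ) < n + 1 := by positivity
      field_simp
      rw [h', hi]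
      ring

end Boundary

/-! ### Extension from horns and from the sides of a prism -/

/-- The facets `φ i` cover the horn at the vertex `k`. -/
structure CoversHorn {n m : ℕ} (k : Fin (n + 2)) (φ : Fin m → Fin (n + 1) → Fin (n + 2)) :
    Prop where
  injective : ∀ i, (φ i).Injective
  cover : ∀ j, j ≠ k → ∃ i, ∀ l, l ≠ j → ∃ s, φ i s = l
  miss : ∀ i, ∃ j, j ≠ k ∧ ∀ s, φ i s ≠ j

namespace CoversHorn

variable {M Z : Type*} [TopologicalSpace M] [TopologicalSpace Z] [CompactSpace Z] [T2Space Z]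
  {n m : ℕ} {k : Fin (n + 2)} {φ : Fin m → Fin (n + 1) → Fin (n + 2)}

theorem simplexMap_mem (h : CoversHorn k φ) (i : Fin m) (x : stdSimplex ℝ (Fin (n + 1))) :
    simplexMap (φ i) x ∈ simplexHorn k := by
  obtain ⟨j, hj, hs⟩ := h.miss i
  exact ⟨j, hj, simplexMap_apply_of_notMem x fun ⟨s, e⟩ => hs s e⟩

theorem exists_simplexMap_eq (h : CoversHorn k φ) {x : stdSimplex ℝ (Fin (n + 2))}
    (hx : x ∈ simplexHorn k) : ∃ i y, simplexMap (φ i) y = x := by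
  obtain ⟨j, hj, hxj⟩ := hx
  obtain ⟨i, hi⟩ := h.cover j hj
  refine ⟨i, _root_.exists_simplexMap_eq (h.injective i) x fun l hl => ?_⟩
  by_cases e : l = j
  · rw [e, hxj]
  · exact absurd (hi l e) hl

/-- It suffices to check compatibility of maps on the facets for pairs in increasing order. -/
theorem compatible_of_lt {β : Type*} (h : CoversHorn k φ)
    (F : Fin m → stdSimplex ℝ (Fin (n + 1)) → β)
    (hF : ∀ i j, i < j → ∀ x y, simplexMap (φ i) x = simplexMap (φ j) y → F i x = F j y)
    (i j : Fin m) (x y : stdSimplex ℝ (Fin (n + 1)))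
    (e : simplexMap (φ i) x = simplexMap (φ j) y) : F i x = F j y := by
  rcases lt_trichotomy i j with hij | rfl | hij
  · exact hF i j hij x y e
  · rw [simplexMap_injective (h.injective i) e]
  · exact (hF j i hij y x e.symm).symm

/-- Compatible maps on the facets of a horn extend to the simplex. -/
theorem exists_extension (h : CoversHorn k φ) (F : Fin m → C(Z × stdSimplex ℝ (Fin (n + 1)), M))
    (hF : ∀ i j, i < j → ∀ x y z, simplexMap (φ i) x = simplexMap (φ j) y →
      F i (z, x) = F j (z, y)) :
    ∃ G : C(Z × stdSimplex ℝ (Fin (n + 2)), M), ∀ i z x, G (z, simplexMap (φ i) x) = F i (z, x) :=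
  exists_extension_of_pieces (fun i => simplexMap (φ i)) (hornRetraction k)
    (fun x => by
      obtain ⟨i, y, hy⟩ := h.exists_simplexMap_eq (hornRetraction_mem k x)
      exact ⟨i, y, hy.symm⟩)
    (fun i y => hornRetraction_eq_self k (h.simplexMap_mem i y)) F
    (fun i j x y z e => h.compatible_of_lt (fun i x => F i (z, x))
      (fun i j hij x y => hF i j hij x y z) i j x y e)

/-- Compatible maps on the facets of a horn extend to the simplex. -/
theorem exists_filler (h : CoversHorn k φ) (F : Fin m → C(stdSimplex ℝ (Fin (n + 1)), M))
    (hF : ∀ i j, i < j → ∀ x y, simplexMap (φ i) x = simplexMap (φ j) y → F i x = F j y) :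
    ∃ G : C(stdSimplex ℝ (Fin (n + 2)), M), ∀ i, G.comp (simplexMap (φ i)) = F i := by
  obtain ⟨G, hG⟩ := h.exists_extension (Z := Unit) (fun i => (F i).comp ⟨Prod.snd, by fun_prop⟩)
    (fun i j hij x y _ => hF i j hij x y)
  exact ⟨G.comp ⟨fun x => ((), x), by fun_prop⟩, fun i => ContinuousMap.ext fun x => hG i () x⟩

/-- Homotopies of the facets of a horn extend to a homotopy of the simplex. -/
theorem exists_homotopy (h : CoversHorn k φ) (g : C(stdSimplex ℝ (Fin (n + 2)), M))
    (F : Fin m → C(I × stdSimplex ℝ (Fin (n + 1)), M))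
    (hF : ∀ i j, i < j → ∀ x y u, simplexMap (φ i) x = simplexMap (φ j) y →
      F i (u, x) = F j (u, y))
    (hgF : ∀ i x, F i (0, x) = g (simplexMap (φ i) x)) :
    ∃ G : C(I × stdSimplex ℝ (Fin (n + 2)), M), (∀ x, G (0, x) = g x) ∧
      ∀ i u x, G (u, simplexMap (φ i) x) = F i (u, x) := by
  obtain ⟨G, hG₀, hG⟩ := (isBoxRetraction_hornBoxRetraction k).exists_extension (Z := Unit)
    (fun i => simplexMap (φ i)) h.simplexMap_mem (fun x hx => h.exists_simplexMap_eq hx)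
    (g.comp ⟨Prod.snd, by fun_prop⟩) (fun i => (F i).comp ⟨Prod.snd, by fun_prop⟩)
    (fun i j x y _ u e => h.compatible_of_lt (fun i x => F i (u, x))
      (fun i j hij x y => hF i j hij x y u) i j x y e)
    (fun i _ x => hgF i x)
  exact ⟨G.comp ⟨fun p => ((), p), by fun_prop⟩, fun x => hG₀ () x, fun i u x => hG i () u x⟩

end CoversHorn

/-! ### Edges of the triangle and extension over a triangular prism -/

theorem continuous_simplexEdge {n : ℕ} (i j : Fin n) : Continuous (simplexEdge i j) :=
  (stdSimplex.continuous_map _).comp stdSimplexHomeomorphUnitInterval.symm.continuous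

theorem simplexEdge_apply {n : ℕ} (i j l : Fin n) (t : I) :
    simplexEdge i j t l = (if i = l then 1 - (t : ℝ) else 0) + (if j = l then (t : ℝ) else 0) := by
  unfold simplexEdge
  rw [stdSimplex.map_coe, FunOnFinite.linearMap_apply_apply, Finset.sum_filter, Fin.sum_univ_two]
  rfl

theorem simplexEdge_mem_boundary (i j : Fin 3) (t : I) :
    simplexEdge i j t ∈ simplexBoundary 3 := by
  obtain ⟨l, hi, hj⟩ : ∃ l, i ≠ l ∧ j ≠ l := by decide +revert
  exact ⟨l, by simp [simplexEdge_apply, hi, hj]⟩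

/-- The boundary of a triangle is the union of its edges. -/
theorem exists_simplexEdge_eq {x : stdSimplex ℝ (Fin 3)} (hx : x ∈ simplexBoundary 3) :
    (∃ t, simplexEdge 0 1 t = x) ∨ (∃ t, simplexEdge 1 2 t = x) ∨ ∃ t, simplexEdge 0 2 t = x := by
  have hs : x 0 + x 1 + x 2 = 1 := by
    rw [← Fin.sum_univ_three, stdSimplex.sum_eq_one]
  have hI (i : Fin 3) : x i ∈ Set.Icc (0 : ℝ) 1 := ⟨stdSimplex.zero_le x i, stdSimplex.le_one x i⟩
  obtain ⟨i, hi⟩ := hx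
  fin_cases i
  · refine .inr (.inl ⟨⟨x 2, hI 2⟩, stdSimplex.ext (funext fun l => ?_)⟩)
    change x 0 = 0 at hi
    fin_cases l <;> simp [simplexEdge_apply] <;> linarith
  · refine .inr (.inr ⟨⟨x 2, hI 2⟩, stdSimplex.ext (funext fun l => ?_)⟩)
    change x 1 = 0 at hi
    fin_cases l <;> simp [simplexEdge_apply] <;> linarith
  · refine .inl ⟨⟨x 1, hI 1⟩, stdSimplex.ext (funext fun l => ?_)⟩
    change x 2 = 0 at hi
    fin_cases l <;> simp [simplexEdge_apply] <;> linarith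

/-- Homotopies of the three edges of a triangle, depending on a parameter, extend to a homotopy of
the triangle. -/
theorem exists_prism_extension {M Z : Type*} [TopologicalSpace M] [TopologicalSpace Z]
    [CompactSpace Z] [T2Space Z] (g : C(Z × stdSimplex ℝ (Fin 3), M))
    (h₀₁ h₁₂ h₀₂ : C(Z × (I × I), M))
    (hv₀ : ∀ z u, h₀₁ (z, u, 0) = h₀₂ (z, u, 0)) (hv₁ : ∀ z u, h₀₁ (z, u, 1) = h₁₂ (z, u, 0))
    (hv₂ : ∀ z u, h₁₂ (z, u, 1) = h₀₂ (z, u, 1))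
    (hg₀₁ : ∀ z t, h₀₁ (z, 0, t) = g (z, simplexEdge 0 1 t))
    (hg₁₂ : ∀ z t, h₁₂ (z, 0, t) = g (z, simplexEdge 1 2 t))
    (hg₀₂ : ∀ z t, h₀₂ (z, 0, t) = g (z, simplexEdge 0 2 t)) :
    ∃ G : C(Z × (I × stdSimplex ℝ (Fin 3)), M), (∀ z x, G (z, 0, x) = g (z, x)) ∧
      (∀ z u t, G (z, u, simplexEdge 0 1 t) = h₀₁ (z, u, t)) ∧
      (∀ z u t, G (z, u, simplexEdge 1 2 t) = h₁₂ (z, u, t)) ∧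
      ∀ z u t, G (z, u, simplexEdge 0 2 t) = h₀₂ (z, u, t) := by
  have coord {i j i' j' : Fin 3} {t t' : I} (e : simplexEdge i j t = simplexEdge i' j' t')
      (l : Fin 3) := congrArg (fun x : stdSimplex ℝ (Fin 3) => x l) e
  have self {i j : Fin 3} (hij : i ≠ j) {t t' : I} (e : simplexEdge i j t = simplexEdge i j t') :
      t = t' := by
    have := coord e j
    simp only [simplexEdge_apply, hij, if_false, if_true, zero_add] at this
    exact Subtype.ext this
  -- Distinct edges meet only in their common vertex, so the prescribed homotopies need to agree
  -- only over the three vertices.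
  have e₀ {t t' : I} (e : simplexEdge (0 : Fin 3) 1 t = simplexEdge 0 2 t') : t = 0 ∧ t' = 0 := by
    have h₁ := coord e 1
    have h₂ := coord e 2
    simp [simplexEdge_apply] at h₁ h₂
    exact ⟨h₁, Subtype.ext h₂.symm⟩
  have e₁ {t t' : I} (e : simplexEdge (0 : Fin 3) 1 t = simplexEdge 1 2 t') : t = 1 ∧ t' = 0 := by
    have h₁ := coord e 0
    have h₂ := coord e 2
    simp [simplexEdge_apply] at h₁ h₂
    exact ⟨Subtype.ext (by change (t : ℝ) = 1; linarith), Subtype.ext h₂.symm⟩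
  have e₂ {t t' : I} (e : simplexEdge (1 : Fin 3) 2 t = simplexEdge 0 2 t') : t = 1 ∧ t' = 1 := by
    have h₁ := coord e 0
    have h₂ := coord e 1
    simp [simplexEdge_apply] at h₁ h₂
    exact ⟨Subtype.ext (by change (t : ℝ) = 1; linarith),
      Subtype.ext (by change (t' : ℝ) = 1; linarith)⟩
  let q (i j : Fin 3) : C(I, stdSimplex ℝ (Fin 3)) := ⟨simplexEdge i j, continuous_simplexEdge i j⟩
  obtain ⟨G, hG₀, hG⟩ := (isBoxRetraction_boxRetraction (n := 2)).exists_extension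
    ![q 0 1, q 1 2, q 0 2]
    (by
      intro i t
      fin_cases i <;> exact simplexEdge_mem_boundary _ _ _)
    (by
      intro x hx
      rcases exists_simplexEdge_eq hx with ⟨t, h⟩ | ⟨t, h⟩ | ⟨t, h⟩
      exacts [⟨0, t, h⟩, ⟨1, t, h⟩, ⟨2, t, h⟩])
    g ![h₀₁, h₁₂, h₀₂]
    (by
      intro i j t t' z u e
      fin_cases i <;> fin_cases j
      · rw [self (by decide) e]
      · obtain ⟨rfl, rfl⟩ := e₁ e
        exact hv₁ z u
      · obtain ⟨rfl, rfl⟩ := e₀ e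
        exact hv₀ z u
      · obtain ⟨rfl, rfl⟩ := e₁ e.symm
        exact (hv₁ z u).symm
      · rw [self (by decide) e]
      · obtain ⟨rfl, rfl⟩ := e₂ e
        exact hv₂ z u
      · obtain ⟨rfl, rfl⟩ := e₀ e.symm
        exact (hv₀ z u).symm
      · obtain ⟨rfl, rfl⟩ := e₂ e.symm
        exact (hv₂ z u).symm
      · rw [self (by decide) e])
    (by
      intro i z t
      fin_cases i
      exacts [hg₀₁ z t, hg₁₂ z t, hg₀₂ z t])
  exact ⟨G, hG₀, hG 0, hG 1, hG 2⟩

/-! ### Filling triangles and squares -/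

section Filling

variable {M : Type*} [TopologicalSpace M]

/-- The point of a triangle on the segment, at time `u`, from the point at time `t` of the path
through the vertices `0, 1, 2` to the point at time `t` of the edge from `0` to `2`. -/
noncomputable def triangleParam : C(I × I, stdSimplex ℝ (Fin 3)) where
  toFun p :=
    ⟨![(2 - 2 * p.2 - (1 - p.1) * min (2 * p.2 : ℝ) (2 - 2 * p.2)) / 2,
        (1 - p.1) * min (2 * p.2 : ℝ) (2 - 2 * p.2),
        (2 * p.2 - (1 - p.1) * min (2 * p.2 : ℝ) (2 - 2 * p.2)) / 2], by
      have h₀ : (0 : ℝ) ≤ min (2 * p.2 : ℝ) (2 - 2 * p.2) :=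
        le_min (by linarith [p.2.2.1]) (by linarith [p.2.2.2])
      have h₁ : min (2 * p.2 : ℝ) (2 - 2 * p.2) ≤ 2 * p.2 := min_le_left _ _
      have h₂ : min (2 * p.2 : ℝ) (2 - 2 * p.2) ≤ 2 - 2 * p.2 := min_le_right _ _
      have hu : (0 : ℝ) ≤ 1 - p.1 := sub_nonneg.2 p.1.2.2
      have h₃ : (1 - p.1) * min (2 * p.2 : ℝ) (2 - 2 * p.2) ≤ min (2 * p.2 : ℝ) (2 - 2 * p.2) :=
        mul_le_of_le_one_left h₀ (by linarith [p.1.2.1])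
      have h₄ := mul_nonneg hu h₀
      intro i
      fin_cases i
      · change 0 ≤ (2 - 2 * (p.2 : ℝ) - _) / 2
        linarith
      · exact h₄
      · change 0 ≤ (2 * (p.2 : ℝ) - _) / 2
        linarith, by
      rw [Fin.sum_univ_three]
      change (2 - 2 * (p.2 : ℝ) - (1 - p.1) * min (2 * p.2 : ℝ) (2 - 2 * p.2)) / 2 +
        (1 - p.1) * min (2 * p.2 : ℝ) (2 - 2 * p.2) +
        (2 * (p.2 : ℝ) - (1 - p.1) * min (2 * p.2 : ℝ) (2 - 2 * p.2)) / 2 = 1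
      ring⟩
  continuous_toFun := by
    refine Continuous.subtype_mk (continuous_pi fun i => ?_) _
    fin_cases i <;> simp <;> fun_prop

theorem triangleParam_apply_zero (p : I × I) : triangleParam p 0 =
    (2 - 2 * p.2 - (1 - p.1) * min (2 * p.2 : ℝ) (2 - 2 * p.2)) / 2 := rfl

theorem triangleParam_apply_one (p : I × I) : triangleParam p 1 =
    (1 - p.1) * min (2 * p.2 : ℝ) (2 - 2 * p.2) := rfl

theorem triangleParam_apply_two (p : I × I) : triangleParam p 2 =
    (2 * p.2 - (1 - p.1) * min (2 * p.2 : ℝ) (2 - 2 * p.2)) / 2 := rfl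

/-- The parameter `t` is read off from `x 2 - x 0 = 2 t - 1`, and `u` then from the middle
coordinate. -/
theorem triangleParam_surjective : Function.Surjective triangleParam := by
  intro x
  have hs : x 0 + x 1 + x 2 = 1 := by
    rw [← Fin.sum_univ_three, stdSimplex.sum_eq_one]
  have h₀ := stdSimplex.zero_le x 0
  have h₁ := stdSimplex.zero_le x 1
  have h₂ := stdSimplex.zero_le x 2
  let t : I := ⟨(1 - x 0 + x 2) / 2, by linarith, by linarith⟩
  have ht : (t : ℝ) = (1 - x 0 + x 2) / 2 := rfl
  -- Here `u` is found by dividing by the tent function; where the tent vanishes, any `u` will do.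
  obtain ⟨u, hu⟩ : ∃ u : I, (1 - u) * min (2 * t : ℝ) (2 - 2 * t) = x 1 := by
    have hm : x 1 ≤ min (2 * t : ℝ) (2 - 2 * t) := le_min (by linarith) (by linarith)
    rcases (h₁.trans hm).eq_or_lt with h | h
    · refine ⟨0, ?_⟩
      rw [← h] at hm ⊢
      linarith
    · have h' : x 1 / min (2 * t : ℝ) (2 - 2 * t) ≤ 1 := (div_le_one h).2 hm
      have h'' : 0 ≤ x 1 / min (2 * t : ℝ) (2 - 2 * t) := by positivity
      refine ⟨⟨1 - x 1 / min (2 * t : ℝ) (2 - 2 * t), by linarith, by linarith⟩, ?_⟩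
      change (1 - (1 - _)) * _ = _
      rw [sub_sub_cancel, div_mul_cancel₀ _ h.ne']
  refine ⟨(u, t), stdSimplex.ext (funext fun i => ?_)⟩
  fin_cases i
  · change triangleParam (u, t) 0 = x 0
    rw [triangleParam_apply_zero, hu]
    linarith
  · exact hu
  · change triangleParam (u, t) 2 = x 2
    rw [triangleParam_apply_two, hu]
    linarith

/-- The parametrization collapses only the sides `t = 0` and `t = 1` of the square, on which a
homotopy of paths is constant; this lets such a homotopy descend to the triangle. -/
theorem eq_of_triangleParam_eq {p p' : I × I} (h : triangleParam p = triangleParam p') :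
    p = p' ∨ p.2 = 0 ∧ p'.2 = 0 ∨ p.2 = 1 ∧ p'.2 = 1 := by
  obtain ⟨u, t⟩ := p
  obtain ⟨u', t'⟩ := p'
  have h₀ := congrArg (fun x : stdSimplex ℝ (Fin 3) => x 0) h
  have h₁ := congrArg (fun x : stdSimplex ℝ (Fin 3) => x 1) h
  simp only [triangleParam_apply_zero, triangleParam_apply_one] at h₀ h₁
  obtain rfl : t = t' := Subtype.ext (by linarith)
  have hm : (0 : ℝ) ≤ min (2 * t : ℝ) (2 - 2 * t) :=
    le_min (by linarith [t.2.1]) (by linarith [t.2.2])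
  rcases hm.eq_or_lt with hm | hm
  · right
    rcases min_choice (2 * t : ℝ) (2 - 2 * t) with e | e
    · have : t = 0 := Subtype.ext (by change (t : ℝ) = 0; linarith)
      exact .inl ⟨this, this⟩
    · have : t = 1 := Subtype.ext (by change (t : ℝ) = 1; linarith)
      exact .inr ⟨this, this⟩
  · left
    have := mul_right_cancel₀ hm.ne' h₁
    rw [show u = u' from Subtype.ext (by linarith)]

theorem triangleParam_edge₀₁ (t : I) :
    triangleParam (0, ⟨t / 2, by linarith [t.2.1], by linarith [t.2.2]⟩) = simplexEdge 0 1 t := by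
  have hm : min (2 * (t / 2) : ℝ) (2 - 2 * (t / 2)) = t := by
    rw [min_eq_left (by linarith [t.2.2])]
    ring
  refine stdSimplex.ext (funext fun i => ?_)
  fin_cases i
  · simp [triangleParam_apply_zero, simplexEdge_apply, hm]
    ring
  · simp [triangleParam_apply_one, simplexEdge_apply, hm]
  · simp [triangleParam_apply_two, simplexEdge_apply, hm]
    ring

theorem triangleParam_edge₁₂ (t : I) :
    triangleParam (0, ⟨(t + 1) / 2, by linarith [t.2.1], by linarith [t.2.2]⟩) =
      simplexEdge 1 2 t := by
  have hm : min (2 * ((t + 1) / 2) : ℝ) (2 - 2 * ((t + 1) / 2)) = 1 - t := by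
    rw [min_eq_right (by linarith [t.2.1])]
    ring
  refine stdSimplex.ext (funext fun i => ?_)
  fin_cases i
  · simp [triangleParam_apply_zero, simplexEdge_apply, hm]
    ring
  · simp [triangleParam_apply_one, simplexEdge_apply, hm]
  · simp [triangleParam_apply_two, simplexEdge_apply, hm]
    ring

theorem triangleParam_edge₀₂ (t : I) : triangleParam (1, t) = simplexEdge 0 2 t := by
  refine stdSimplex.ext (funext fun i => ?_)
  fin_cases i
  · simp [triangleParam_apply_zero, simplexEdge_apply]
    ring
  · simp [triangleParam_apply_one, simplexEdge_apply]
  · simp [triangleParam_apply_two, simplexEdge_apply]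

/-- A triangle of paths that commutes up to homotopy can be filled. -/
theorem exists_triangle {x y z : M} {p : Path x y} {q : Path y z} {r : Path x z}
    (h : (p.trans q).Homotopic r) : ∃ a : C(stdSimplex ℝ (Fin 3), M),
      (∀ t, a (simplexEdge 0 1 t) = p t) ∧ (∀ t, a (simplexEdge 1 2 t) = q t) ∧
      ∀ t, a (simplexEdge 0 2 t) = r t := by
  obtain ⟨H⟩ := h
  obtain ⟨a, ha⟩ := exists_extension_of_retraction triangleParam H.toContinuousMap (by
      rintro ⟨u, t⟩ ⟨u', t'⟩ e
      rcases eq_of_triangleParam_eq e with e | ⟨e, e'⟩ | ⟨e, e'⟩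
      · rw [e]
      · obtain rfl : t = 0 := e
        obtain rfl : t' = 0 := e'
        exact (H.source u).trans (H.source u').symm
      · obtain rfl : t = 1 := e
        obtain rfl : t' = 1 := e'
        exact (H.target u).trans (H.target u').symm)
    (ContinuousMap.id _) (fun x => triangleParam_surjective x) (fun _ => rfl)
  refine ⟨a, fun t => ?_, fun t => ?_, fun t => ?_⟩
  · rw [← triangleParam_edge₀₁, ha]
    refine (H.apply_zero _).trans ?_
    change (p.trans q) _ = _
    rw [Path.trans_apply, dif_pos (by change (t / 2 : ℝ) ≤ 1 / 2; linarith [t.2.2])]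
    congr 1
    exact Subtype.ext (by simp; ring)
  · rw [← triangleParam_edge₁₂, ha]
    refine (H.apply_zero _).trans ?_
    change (p.trans q) _ = _
    rw [Path.trans_apply]
    split_ifs with h
    · have h' : ((t + 1) / 2 : ℝ) ≤ 1 / 2 := h
      obtain rfl : t = 0 := Subtype.ext (le_antisymm (by simp; linarith) t.2.1)
      rw [q.source]
      convert! p.target
      simp
    · congr 1
      exact Subtype.ext (by simp; ring)
  · rw [← triangleParam_edge₀₂, ha]
    exact H.apply_one t

/-- A square of paths that commutes up to homotopy can be filled. -/
theorem exists_square {x y y' z : M} {p : Path x y} {q : Path y z} {p' : Path x y'}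
    {q' : Path y' z} (h : (p.trans q).Homotopic (p'.trans q')) : ∃ S : C(I × I, M),
      (∀ u, S (u, 0) = p u) ∧ (∀ t, S (1, t) = q t) ∧ (∀ t, S (0, t) = p' t) ∧
      ∀ u, S (u, 1) = q' u := by
  -- The square is cut along its diagonal. The half below is filled by the given homotopy, the half
  -- above by a constant one, and both carry `p'.trans q'` on the diagonal.
  obtain ⟨a, ha₀, ha₁, ha₂⟩ := exists_triangle h
  obtain ⟨b, hb₀, hb₁, hb₂⟩ := exists_triangle (Path.Homotopic.refl (p'.trans q'))
  -- `T` folds the square along the diagonal, so that either half is mapped onto the triangle.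
  let T : I × I → stdSimplex ℝ (Fin 3) := fun w =>
    ⟨![1 - max (w.1 : ℝ) w.2, max (w.1 : ℝ) w.2 - min (w.1 : ℝ) w.2, min (w.1 : ℝ) w.2], by
      intro i
      fin_cases i
      · exact sub_nonneg.2 (max_le w.1.2.2 w.2.2.2)
      · exact sub_nonneg.2 min_le_max
      · exact le_min w.1.2.1 w.2.2.1, by
      rw [Fin.sum_univ_three]
      change (1 - max (w.1 : ℝ) w.2) + (max (w.1 : ℝ) w.2 - min (w.1 : ℝ) w.2) +
        min (w.1 : ℝ) w.2 = 1
      ring⟩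
  have hT : Continuous T := by
    refine Continuous.subtype_mk (continuous_pi fun i => ?_) _
    fin_cases i <;> simp <;> fun_prop
  have T₀ (t : I) : T (t, 0) = simplexEdge 0 1 t ∧ T (0, t) = simplexEdge 0 1 t := by
    constructor <;> refine stdSimplex.ext (funext fun i => ?_) <;>
      fin_cases i <;> rw [simplexEdge_apply] <;> simp [T, DFunLike.coe, t.2.1]
  have T₁ (t : I) : T (t, 1) = simplexEdge 1 2 t ∧ T (1, t) = simplexEdge 1 2 t := by
    constructor <;> refine stdSimplex.ext (funext fun i => ?_) <;>
      fin_cases i <;> rw [simplexEdge_apply] <;> simp [T, DFunLike.coe, t.2.2]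
  have T₂ (t : I) : T (t, t) = simplexEdge 0 2 t := by
    refine stdSimplex.ext (funext fun i => ?_)
    fin_cases i <;> rw [simplexEdge_apply] <;> simp [T, DFunLike.coe]
  let S : C(I × I, M) := ⟨fun w => if w.2 ≤ w.1 then a (T w) else b (T w), by
    refine Continuous.if_le (by fun_prop) (by fun_prop) continuous_snd continuous_fst ?_
    rintro ⟨u, t⟩ e
    obtain rfl : t = u := e
    rw [T₂, ha₂, hb₂]⟩
  have hS (w : I × I) : S w = if w.2 ≤ w.1 then a (T w) else b (T w) := rfl
  refine ⟨S, fun u => ?_, fun t => ?_, fun t => ?_, fun u => ?_⟩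
  · rw [hS, if_pos unitInterval.nonneg', (T₀ u).1, ha₀]
  · rw [hS, if_pos unitInterval.le_one', (T₁ t).2, ha₁]
  · rw [hS]
    split_ifs with h
    · obtain rfl : t = 0 := le_antisymm h unitInterval.nonneg'
      rw [(T₀ 0).2, ha₀, p.source, p'.source]
    · rw [(T₀ t).2, hb₀]
  · rw [hS]
    split_ifs with h
    · obtain rfl : u = 1 := le_antisymm unitInterval.le_one' h
      rw [(T₁ 1).1, ha₁, q.target, q'.target]
    · rw [(T₁ u).1, hb₁]

end Filling

/-! ### Existence of based curves, of simplices and of homotopies of curves -/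

theorem eq_one_of_inv_eq_self {G : Type*} [Group G] (hG : ∀ g : G, orderOf g ≠ 2) {g : G}
    (h : g⁻¹ = g) : g = 1 := by
  by_contra h1
  refine hG g (orderOf_eq_prime ?_ h1)
  rw [pow_two]
  nth_rewrite 1 [← h]
  exact inv_mul_cancel g

/-- In a group without elements of order two one can choose one element of each pair of inverse
elements. -/
theorem exists_set_mem_iff_inv_notMem {G : Type*} [Group G] (hG : ∀ g : G, orderOf g ≠ 2) :
    ∃ S : Set G, ∀ g, g ≠ 1 → (g⁻¹ ∈ S ↔ g ∉ S) := by
  classical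
  -- Any linear order will do: of `g` and `g⁻¹` the smaller one is taken, and they differ unless `g
  -- = 1`.
  let _ : LinearOrder G := linearOrderOfSTO WellOrderingRel
  refine ⟨{g | g < g⁻¹}, fun g hg => ?_⟩
  have hne : g⁻¹ ≠ g := fun h => hg (eq_one_of_inv_eq_self hG h)
  simp only [Set.mem_ofPred_eq, inv_inv, not_lt]
  exact ⟨le_of_lt, fun h => lt_of_le_of_ne h hne⟩

/-- Choices indexed by a group without elements of order two can be made compatible with inverses
and prescribed at the neutral element. -/
theorem exists_choice_inv {G T : Type*} [Group G] (hG : ∀ g : G, orderOf g ≠ 2) {τ : T → T}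
    (hτ : τ.Involutive) {R : G → T → Prop} (hR : ∀ g x, R g x → R g⁻¹ (τ x))
    (hex : ∀ g, ∃ x, R g x) {x₁ : T} (h₁ : R 1 x₁) (hτ₁ : τ x₁ = x₁) :
    ∃ F : G → T, (∀ g, R g (F g)) ∧ (∀ g, F g⁻¹ = τ (F g)) ∧ F 1 = x₁ := by
  classical
  obtain ⟨S, hS⟩ := exists_set_mem_iff_inv_notMem hG
  choose K hK using hex
  refine ⟨fun g => if g = 1 then x₁ else if g ∈ S then K g else τ (K g⁻¹),
    fun g => ?_, fun g => ?_, if_pos rfl⟩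
  · beta_reduce
    split_ifs with h h'
    · rw [h]
      exact h₁
    · exact hK g
    · simpa using hR _ _ (hK g⁻¹)
  · by_cases h : g = 1
    · simp [h, hτ₁]
    · by_cases h' : g ∈ S
      · have h'' : g⁻¹ ∉ S := fun e => (hS g h).1 e h'
        simp [h, h', h'']
      · have h'' : g⁻¹ ∈ S := (hS g h).2 h'
        simp [h, h', h'', hτ (K g⁻¹)]

section Existence

variable {M N : Type*} [TopologicalSpace M] [TopologicalSpace N] {m₀ : M} {n₀ : N}

theorem LoopSection.nonempty_of_orderOf_ne_two
    (hM : ∀ α : FundamentalGroup M m₀, orderOf α ≠ 2) : Nonempty (LoopSection M m₀) := by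
  obtain ⟨F, hF, hinv, hone⟩ := exists_choice_inv hM (T := Path m₀ m₀) (τ := Path.symm)
    (fun p => p.symm_symm)
    (R := fun α p => FundamentalGroup.fromPath (Path.Homotopic.Quotient.mk p) = α)
    (fun α p h => congrArg (fun β : FundamentalGroup M m₀ => β⁻¹) h)
    (fun α => Path.Homotopic.Quotient.mk_surjective (FundamentalGroup.toPath α))
    (x₁ := Path.refl m₀) rfl Path.refl_symm
  exact ⟨⟨F, hF, hinv, hone⟩⟩

/-- This is the hypothesis under which `exists_triangle` fills the boundary of a simplex in `Γ(α,
β)`. -/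
theorem LoopSection.homotopic_trans (s : LoopSection M m₀) (α β : FundamentalGroup M m₀) :
    ((s.loop α).trans (s.loop β)).Homotopic (s.loop (β * α)) := by
  apply Path.Homotopic.Quotient.exact
  have h : FundamentalGroup.fromPath (Path.Homotopic.Quotient.mk (s.loop (β * α))) =
      FundamentalGroup.fromPath (Path.Homotopic.Quotient.mk (s.loop β)) *
        FundamentalGroup.fromPath (Path.Homotopic.Quotient.mk (s.loop α)) := by
    rw [s.mk_loop, s.mk_loop, s.mk_loop]
  -- The product in the fundamental group unfolds to concatenation with the right factor traversed
  -- first.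
  exact h.symm

theorem nonempty_Gam (s : LoopSection M m₀) (α β : FundamentalGroup M m₀) :
    Nonempty (Gam s α β) := by
  obtain ⟨a, h₀, h₁, h₂⟩ := exists_triangle (s.homotopic_trans α β)
  exact ⟨TwoSimplex.cls ⟨a, h₀, h₁, h₂⟩⟩

/-- The class `f_* α` is represented by the reverse of `c`, then `f ∘ s(α)`, then `c`; prefixing `c`
cancels its reverse. This is the commuting square from which the homotopy of curves is filled. -/
theorem homotopic_trans_inducedHom (s : LoopSection M m₀) (s' : LoopSection N n₀) (f : C(M, N))
    (c : Path (f m₀) n₀) (α : FundamentalGroup M m₀) :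
    (c.trans (s'.loop (inducedHom f c α))).Homotopic
      (((s.loop α).map f.continuous).trans c) := by
  apply Path.Homotopic.Quotient.exact
  have h : inducedHom f c α = (Path.Homotopic.Quotient.mk c).symm.trans
      (((FundamentalGroup.toPath α).map f).trans (Path.Homotopic.Quotient.mk c)) := rfl
  have hα : (FundamentalGroup.toPath α).map f =
      Path.Homotopic.Quotient.mk ((s.loop α).map f.continuous) :=
    congrArg (fun β : FundamentalGroup M m₀ => (FundamentalGroup.toPath β).map f)
      (s.mk_loop α).symm
  have h' : Path.Homotopic.Quotient.mk (s'.loop (inducedHom f c α)) = inducedHom f c α :=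
    s'.mk_loop _
  change Path.Homotopic.Quotient.mk (c.trans (s'.loop (inducedHom f c α))) =
    Path.Homotopic.Quotient.mk (((s.loop α).map f.continuous).trans c)
  rw [Path.Homotopic.Quotient.mk_trans, Path.Homotopic.Quotient.mk_trans, h', h, hα,
    ← Path.Homotopic.Quotient.trans_assoc, Path.Homotopic.Quotient.trans_symm,
    Path.Homotopic.Quotient.refl_trans]

/-- A homotopy of curves whose endpoints move along `c` is a filled square. Squares are chosen for
one member of each inverse pair and reflected in `t` for the other. -/
theorem EdgeHomotopies.nonempty_of_orderOf_ne_two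
    (hM : ∀ α : FundamentalGroup M m₀, orderOf α ≠ 2) (s : LoopSection M m₀)
    (s' : LoopSection N n₀) (f : C(M, N)) (c : Path (f m₀) n₀) :
    Nonempty (EdgeHomotopies s s' f c) := by
  obtain ⟨F, hF, hinv, -⟩ := exists_choice_inv hM (T := C(I × I, N))
    (τ := fun K => K.comp ⟨fun p => (p.1, σ p.2), by fun_prop⟩)
    (fun K => by ext; simp)
    (R := fun α K => (∀ t, K (0, t) = f (s.loop α t)) ∧
      (∀ t, K (1, t) = s'.loop (inducedHom f c α) t) ∧ (∀ u, K (u, 0) = c u) ∧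
      ∀ u, K (u, 1) = c u)
    (fun α K ⟨h₁, h₂, h₃, h₄⟩ => by
      refine ⟨fun t => ?_, fun t => ?_, fun u => ?_, fun u => ?_⟩
      · simp [h₁, s.loop_inv]
      · simp [h₂, s'.loop_inv]
      · simp [h₄]
      · simp [h₃])
    (fun α => by
      obtain ⟨K, h₀, h₁, h₂, h₃⟩ := exists_square (homotopic_trans_inducedHom s s' f c α)
      exact ⟨K, h₂, h₁, h₀, h₃⟩)
    -- At the neutral element both based curves are constant, and the homotopy `(u, t) ↦ c u` is
    -- invariant under reflection.
    (x₁ := ⟨fun p => c p.1, by fun_prop⟩)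
    (by
      refine ⟨fun t => ?_, fun t => ?_, fun u => rfl, fun u => rfl⟩
      · rw [s.loop_one]
        exact c.source
      · rw [map_one, s'.loop_one]
        exact c.target)
    rfl
  exact ⟨⟨F, fun α => (hF α).1, fun α => (hF α).2.1, fun α => (hF α).2.2.1,
    fun α => (hF α).2.2.2, fun α u t => by rw [hinv]; rfl⟩⟩

end Existence

/-! ### The operations on `Γ(M)` -/

theorem comp_simplexMap_comp_eq {M : Type*} [TopologicalSpace M] {n k k' l : ℕ}
    {f : Fin n → Fin k} {g : Fin k → Fin l} {f' : Fin n → Fin k'} {g' : Fin k' → Fin l}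
    (ω : C(stdSimplex ℝ (Fin l), M)) (h : g ∘ f = g' ∘ f') :
    (ω.comp (simplexMap g)).comp (simplexMap f) = (ω.comp (simplexMap g')).comp (simplexMap f') := by
  rw [ContinuousMap.comp_assoc, ContinuousMap.comp_assoc, simplexMap_comp, simplexMap_comp, h]

/-- Two facets of a tetrahedron meet in an edge. -/
theorem exists_edge_of_simplexMap_eq {n : ℕ} {f g : Fin 3 → Fin n} (i j i' j' : Fin 3)
    (hf : f.Injective) (hg : g.Injective) (hij : i ≠ j) (hi : f i = g i') (hj : f j = g j')
    (h : ∀ k l, f k = g l → k = i ∨ k = j) {x y : stdSimplex ℝ (Fin 3)}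
    (hxy : simplexMap f x = simplexMap g y) :
    ∃ t, simplexEdge i j t = x ∧ simplexEdge i' j' t = y := by
  obtain ⟨z, hz, hz'⟩ := exists_of_simplexMap_eq (θ := ![i, j]) (θ' := ![i', j']) hf hg
    (by
      intro a b hab
      fin_cases a <;> fin_cases b <;> simp_all [eq_comm])
    (by
      funext a
      fin_cases a
      exacts [hi, hj])
    (by
      intro k l e
      rcases h k l e with rfl | rfl
      exacts [⟨0, rfl⟩, ⟨1, rfl⟩]) hxy
  refine ⟨stdSimplexHomeomorphUnitInterval z, ?_, ?_⟩ <;> unfold simplexEdge <;>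
    rw [Homeomorph.symm_apply_apply]
  exacts [hz, hz']

/-- The three given faces in the definition of the ternary operation. -/
def gluingFaces : Fin 3 → Fin 3 → Fin 4 :=
  ![![1, 2, 0], ![0, 2, 3], ![1, 0, 3]]

/-- All three faces contain the vertex 0, and the fourth face `[1,2,3]` is the one opposite to it.
-/
theorem coversHorn_gluingFaces : CoversHorn 0 gluingFaces where
  injective := by unfold gluingFaces; decide
  cover := by unfold gluingFaces; decide
  miss := by unfold gluingFaces; decide

/-- Two of the three faces share one edge. The first two traverse theirs in opposite directions,
which is why `β⁻¹` occurs in the type of `a` and `β` in that of `b`. -/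
theorem gluingFaces_compatible {B : Type*} (F : Fin 3 → stdSimplex ℝ (Fin 3) → B)
    (h₀₁ : ∀ t, F 0 (simplexEdge 2 1 t) = F 1 (simplexEdge 0 1 t))
    (h₀₂ : ∀ t, F 0 (simplexEdge 0 2 t) = F 2 (simplexEdge 0 1 t))
    (h₁₂ : ∀ t, F 1 (simplexEdge 0 2 t) = F 2 (simplexEdge 1 2 t)) (i j : Fin 3) (hij : i < j)
    (x y : stdSimplex ℝ (Fin 3))
    (e : simplexMap (gluingFaces i) x = simplexMap (gluingFaces j) y) : F i x = F j y := by
  have hinj := coversHorn_gluingFaces.injective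
  obtain ⟨rfl, rfl⟩ | ⟨rfl, rfl⟩ | ⟨rfl, rfl⟩ :
      (i = 0 ∧ j = 1) ∨ (i = 0 ∧ j = 2) ∨ (i = 1 ∧ j = 2) := by
    clear e
    decide +revert
  · obtain ⟨t, rfl, rfl⟩ := exists_edge_of_simplexMap_eq 2 1 0 1 (hinj 0) (hinj 1) (by decide)
      rfl rfl (by unfold gluingFaces; decide) e
    exact h₀₁ t
  · obtain ⟨t, rfl, rfl⟩ := exists_edge_of_simplexMap_eq 0 2 0 1 (hinj 0) (hinj 2) (by decide)
      rfl rfl (by unfold gluingFaces; decide) e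
    exact h₀₂ t
  · obtain ⟨t, rfl, rfl⟩ := exists_edge_of_simplexMap_eq 0 2 1 2 (hinj 1) (hinj 2) (by decide)
      rfl rfl (by unfold gluingFaces; decide) e
    exact h₁₂ t

/-- The faces of a 4-simplex that are given in the associativity law. -/
def associativityFaces : Fin 4 → Fin 4 → Fin 5 :=
  ![![0, 1, 2, 3], ![3, 1, 2, 4], ![3, 0, 2, 4], ![3, 1, 0, 4]]

/-- The four facets contain the vertex 3, and each lists its vertices in the order in which the
corresponding product is formed. -/
theorem coversHorn_associativityFaces : CoversHorn 3 associativityFaces where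
  injective := by unfold associativityFaces; decide
  cover := by unfold associativityFaces; decide
  miss := by unfold associativityFaces; decide

theorem associativityFaces_compatible {M : Type*} [TopologicalSpace M]
    (F : Fin 4 → C(stdSimplex ℝ (Fin 4), M))
    (h₀₁ : (F 0).comp (simplexMap ![1, 2, 3]) = (F 1).comp (simplexMap ![1, 2, 0]))
    (h₀₂ : (F 0).comp (simplexMap ![0, 2, 3]) = (F 2).comp (simplexMap ![1, 2, 0]))
    (h₀₃ : (F 0).comp (simplexMap ![1, 0, 3]) = (F 3).comp (simplexMap ![1, 2, 0]))
    (h₁₂ : (F 1).comp (simplexMap ![0, 2, 3]) = (F 2).comp (simplexMap ![0, 2, 3]))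
    (h₁₃ : (F 1).comp (simplexMap ![1, 0, 3]) = (F 3).comp (simplexMap ![1, 0, 3]))
    (h₂₃ : (F 2).comp (simplexMap ![0, 1, 3]) = (F 3).comp (simplexMap ![0, 2, 3]))
    (i j : Fin 4) (hij : i < j) (x y : stdSimplex ℝ (Fin 4))
    (e : simplexMap (associativityFaces i) x = simplexMap (associativityFaces j) y) :
    F i x = F j y := by
  have key (i j : Fin 4) (θ θ' : Fin 3 → Fin 4) (hθ : θ.Injective)
      (hθθ' : associativityFaces i ∘ θ = associativityFaces j ∘ θ')
      (h : ∀ k l, associativityFaces i k = associativityFaces j l → ∃ a, θ a = k)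
      (e : simplexMap (associativityFaces i) x = simplexMap (associativityFaces j) y)
      (hF : (F i).comp (simplexMap θ) = (F j).comp (simplexMap θ')) : F i x = F j y := by
    obtain ⟨z, rfl, rfl⟩ := exists_of_simplexMap_eq (coversHorn_associativityFaces.injective i)
      (coversHorn_associativityFaces.injective j) hθ hθθ' h e
    exact congrArg (fun f : C(stdSimplex ℝ (Fin 3), M) => f z) hF
  obtain ⟨rfl, rfl⟩ | ⟨rfl, rfl⟩ | ⟨rfl, rfl⟩ | ⟨rfl, rfl⟩ | ⟨rfl, rfl⟩ | ⟨rfl, rfl⟩ :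
      (i = 0 ∧ j = 1) ∨ (i = 0 ∧ j = 2) ∨ (i = 0 ∧ j = 3) ∨ (i = 1 ∧ j = 2) ∨ (i = 1 ∧ j = 3) ∨
        (i = 2 ∧ j = 3) := by
    clear e
    decide +revert
  · exact key 0 1 ![1, 2, 3] ![1, 2, 0] (by decide) (by decide) (by decide) e h₀₁
  · exact key 0 2 ![0, 2, 3] ![1, 2, 0] (by decide) (by decide) (by decide) e h₀₂
  · exact key 0 3 ![1, 0, 3] ![1, 2, 0] (by decide) (by decide) (by decide) e h₀₃
  · exact key 1 2 ![0, 2, 3] ![0, 2, 3] (by decide) (by decide) (by decide) e h₁₂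
  · exact key 1 3 ![1, 0, 3] ![1, 0, 3] (by decide) (by decide) (by decide) e h₁₃
  · exact key 2 3 ![0, 1, 3] ![0, 2, 3] (by decide) (by decide) (by decide) e h₂₃

/-! ### Existence and uniqueness of the glued face -/

namespace TwoSimplex

variable {M : Type*} [TopologicalSpace M] {m₀ : M} {s : LoopSection M m₀}
  {α β γ α' β' : FundamentalGroup M m₀}

/-- A 2-simplex, with its boundary curves indexed by equal elements of the fundamental group. -/
def copy (a : TwoSimplex s α β) (hα : α = α') (hβ : β = β') : TwoSimplex s α' β' where
  toMap := a.toMap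
  edge01 := hα ▸ a.edge01
  edge12 := hβ ▸ a.edge12
  edge02 := hα ▸ hβ ▸ a.edge02

theorem copy_toMap (a : TwoSimplex s α β) (hα : α = α') (hβ : β = β') :
    (a.copy hα hβ).toMap = a.toMap := rfl

theorem rot_toMap (a : TwoSimplex s α β) :
    a.rot.toMap = a.toMap.comp (simplexMap ![1, 2, 0]) := rfl

theorem flip_toMap (a : TwoSimplex s α β) :
    a.flip.toMap = a.toMap.comp (simplexMap ![1, 0, 2]) := rfl

/-- Transport passes from classes to representatives, where it leaves the underlying map untouched;
the laws then become identities between maps. -/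
theorem reindex_cls (a : TwoSimplex s α β) (hα : α = α') (hβ : β = β') :
    reindex (T := Gam s) hα hβ a.cls = (a.copy hα hβ).cls := by
  subst hα hβ
  rfl

theorem cls_eq_iff {a b : TwoSimplex s α β} :
    a.cls = b.cls ↔ a.toMap.HomotopicRel b.toMap (simplexBoundary 3) :=
  Quotient.eq (r := TwoSimplex.setoid s α β)

theorem cls_eq_of_toMap_eq {a b : TwoSimplex s α β} (h : a.toMap = b.toMap) : a.cls = b.cls :=
  cls_eq_iff.2 (h ▸ .refl _)

theorem exists_cls_eq (A : Gam s α β) : ∃ a : TwoSimplex s α β, a.cls = A :=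
  Quotient.exists_rep A

theorem edge21 (a : TwoSimplex s α β) (t : I) :
    a.toMap (simplexEdge 2 1 t) = s.loop β (σ t) := by
  rw [simplexEdge_symm, a.edge12]

theorem exists_glues (a : TwoSimplex s α β⁻¹) (b : TwoSimplex s β γ⁻¹)
    (c : TwoSimplex s (β⁻¹ * α) (γ⁻¹ * β)) : ∃ d : TwoSimplex s α γ⁻¹, Glues a b c d := by
  obtain ⟨ω, hω⟩ := coversHorn_gluingFaces.exists_filler ![a.toMap, b.toMap, c.toMap]
    (gluingFaces_compatible (fun i => ![a.toMap, b.toMap, c.toMap] i)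
      (fun t => by
        change a.toMap _ = b.toMap _
        rw [a.edge21, b.edge01, s.loop_inv, Path.symm_apply, Function.comp_apply,
          unitInterval.symm_symm])
      (fun t => by
        change a.toMap _ = c.toMap _
        rw [a.edge02, c.edge01])
      (fun t => by
        change b.toMap _ = c.toMap _
        rw [b.edge02, c.edge12]))
  have ha : ω.comp (simplexMap ![1, 2, 0]) = a.toMap := hω 0
  have hb : ω.comp (simplexMap ![0, 2, 3]) = b.toMap := hω 1
  have hc : ω.comp (simplexMap ![1, 0, 3]) = c.toMap := hω 2
  refine ⟨⟨ω.comp (simplexMap ![1, 2, 3]), fun t => ?_, fun t => ?_, fun t => ?_⟩,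
    ω, ha, hb, hc, rfl⟩
  · rw [← a.edge01, ← ha, ContinuousMap.comp_apply, ContinuousMap.comp_apply, simplexMap_edge,
      simplexMap_edge]
    rfl
  · rw [← b.edge12, ← hb, ContinuousMap.comp_apply, ContinuousMap.comp_apply, simplexMap_edge,
      simplexMap_edge]
    rfl
  -- The edge from 1 to 3 of the tetrahedron is also an edge of the face `c`, whose label there is
  -- the product on the right.
  · rw [show γ⁻¹ * α = γ⁻¹ * β * (β⁻¹ * α) by group, ← c.edge02, ← hc, ContinuousMap.comp_apply,
      ContinuousMap.comp_apply, simplexMap_edge, simplexMap_edge]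
    rfl

/-- The homotopies of the three faces extend to a homotopy `G` of tetrahedra. Its ends agree with
`ω` and `ω'` on the horn, hence are homotopic to them relative to it, and the boundary of the fourth
face lies in the horn. -/
theorem Glues.cls_eq {a a' : TwoSimplex s α β⁻¹} {b b' : TwoSimplex s β γ⁻¹}
    {c c' : TwoSimplex s (β⁻¹ * α) (γ⁻¹ * β)} {d d' : TwoSimplex s α γ⁻¹} (h : Glues a b c d)
    (h' : Glues a' b' c' d') (ha : a.cls = a'.cls) (hb : b.cls = b'.cls) (hc : c.cls = c'.cls) :
    d.cls = d'.cls := by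
  rw [cls_eq_iff] at ha hb hc ⊢
  obtain ⟨Ka⟩ := ha
  obtain ⟨Kb⟩ := hb
  obtain ⟨Kc⟩ := hc
  have hKa (u : I) (i j : Fin 3) (t : I) :
      Ka (u, simplexEdge i j t) = a.toMap (simplexEdge i j t) :=
    Ka.eq_fst u (simplexEdge_mem_boundary i j t)
  have hKb (u : I) (i j : Fin 3) (t : I) :
      Kb (u, simplexEdge i j t) = b.toMap (simplexEdge i j t) :=
    Kb.eq_fst u (simplexEdge_mem_boundary i j t)
  have hKc (u : I) (i j : Fin 3) (t : I) :
      Kc (u, simplexEdge i j t) = c.toMap (simplexEdge i j t) :=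
    Kc.eq_fst u (simplexEdge_mem_boundary i j t)
  obtain ⟨ω, ha, hb, hc, hd⟩ := h
  obtain ⟨ω', ha', hb', hc', hd'⟩ := h'
  obtain ⟨G, hG⟩ := coversHorn_gluingFaces.exists_extension
    ![Ka.toContinuousMap, Kb.toContinuousMap, Kc.toContinuousMap]
    (fun i j hij x y u => gluingFaces_compatible
      (fun i x => ![Ka.toContinuousMap, Kb.toContinuousMap, Kc.toContinuousMap] i (u, x))
      (fun t => by
        change Ka (u, _) = Kb (u, _)
        rw [hKa, hKb, a.edge21, b.edge01, s.loop_inv, Path.symm_apply, Function.comp_apply,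
          unitInterval.symm_symm])
      (fun t => by
        change Ka (u, _) = Kc (u, _)
        rw [hKa, hKc, a.edge02, c.edge01])
      (fun t => by
        change Kb (u, _) = Kc (u, _)
        rw [hKb, hKc, b.edge02, c.edge12]) i j hij x y)
  let G' (u : I) : C(stdSimplex ℝ (Fin 4), M) := G.comp ⟨fun x => (u, x), by fun_prop⟩
  have hGa (u : I) (x) : G (u, simplexMap ![1, 2, 0] x) = Ka (u, x) := hG 0 u x
  have hGb (u : I) (x) : G (u, simplexMap ![0, 2, 3] x) = Kb (u, x) := hG 1 u x
  have hGc (u : I) (x) : G (u, simplexMap ![1, 0, 3] x) = Kc (u, x) := hG 2 u x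
  have h₀ : Set.EqOn ω (G' 0) (simplexHorn 0) := by
    intro x hx
    obtain ⟨i, y, rfl⟩ := coversHorn_gluingFaces.exists_simplexMap_eq hx
    fin_cases i
    · exact (congrArg (fun f : C(stdSimplex ℝ (Fin 3), M) => f y) ha).trans
        (((hGa 0 y).trans (Ka.apply_zero y)).symm)
    · exact (congrArg (fun f : C(stdSimplex ℝ (Fin 3), M) => f y) hb).trans
        (((hGb 0 y).trans (Kb.apply_zero y)).symm)
    · exact (congrArg (fun f : C(stdSimplex ℝ (Fin 3), M) => f y) hc).trans
        (((hGc 0 y).trans (Kc.apply_zero y)).symm)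
  have h₁ : Set.EqOn (G' 1) ω' (simplexHorn 0) := by
    intro x hx
    obtain ⟨i, y, rfl⟩ := coversHorn_gluingFaces.exists_simplexMap_eq hx
    fin_cases i
    · exact ((hGa 1 y).trans (Ka.apply_one y)).trans
        (congrArg (fun f : C(stdSimplex ℝ (Fin 3), M) => f y) ha').symm
    · exact ((hGb 1 y).trans (Kb.apply_one y)).trans
        (congrArg (fun f : C(stdSimplex ℝ (Fin 3), M) => f y) hb').symm
    · exact ((hGc 1 y).trans (Kc.apply_one y)).trans
        (congrArg (fun f : C(stdSimplex ℝ (Fin 3), M) => f y) hc').symm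
  have hψ : Set.MapsTo (simplexMap ![1, 2, 3]) (simplexBoundary 3) (simplexHorn (0 : Fin 4)) := by
    rintro x ⟨i, hi⟩
    refine ⟨(![1, 2, 3] : Fin 3 → Fin 4) i, by clear hi; decide +revert, ?_⟩
    rw [simplexMap_apply_of_injective (by decide), hi]
  -- Each edge of the fourth face also lies in one of the three given faces, whose homotopy is
  -- stationary there.
  have hmid : ((G' 0).comp (simplexMap ![1, 2, 3])).HomotopicRel
      ((G' 1).comp (simplexMap ![1, 2, 3])) (simplexBoundary 3) :=
    ⟨{ toFun := fun p => G (p.1, simplexMap ![1, 2, 3] p.2)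
       continuous_toFun := by fun_prop
       map_zero_left := fun _ => rfl
       map_one_left := fun _ => rfl
       prop' := fun u x hx => by
        change G (u, simplexMap ![1, 2, 3] x) = G (0, simplexMap ![1, 2, 3] x)
        rcases exists_simplexEdge_eq hx with ⟨t, rfl⟩ | ⟨t, rfl⟩ | ⟨t, rfl⟩
        · have e : simplexMap (![1, 2, 3] : Fin 3 → Fin 4) (simplexEdge 0 1 t) =
              simplexMap ![1, 2, 0] (simplexEdge 0 1 t) := by
            rw [simplexMap_edge, simplexMap_edge]; rfl
          rw [e, hGa, hGa, hKa, hKa]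
        · have e : simplexMap (![1, 2, 3] : Fin 3 → Fin 4) (simplexEdge 1 2 t) =
              simplexMap ![0, 2, 3] (simplexEdge 1 2 t) := by
            rw [simplexMap_edge, simplexMap_edge]; rfl
          rw [e, hGb, hGb, hKb, hKb]
        · have e : simplexMap (![1, 2, 3] : Fin 3 → Fin 4) (simplexEdge 0 2 t) =
              simplexMap ![1, 0, 3] (simplexEdge 0 2 t) := by
            rw [simplexMap_edge, simplexMap_edge]; rfl
          rw [e, hGc, hGc, hKc, hKc] }⟩
  rw [← hd, ← hd']
  exact (((homotopicRel_horn_of_eqOn 0 h₀).precomp _ hψ).trans hmid).trans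
    ((homotopicRel_horn_of_eqOn 0 h₁).precomp _ hψ)

end TwoSimplex

section Operations

open TwoSimplex

variable {M : Type*} [TopologicalSpace M] {m₀ : M} {s : LoopSection M m₀}
  {α β γ : FundamentalGroup M m₀}

/-- The operation `P` on `Γ(M)`. -/
noncomputable def gamRot (A : Gam s α β) : Gam s β (α⁻¹ * β⁻¹) :=
  Quotient.map (sa := TwoSimplex.setoid s α β) (sb := TwoSimplex.setoid s β (α⁻¹ * β⁻¹))
    TwoSimplex.rot (fun _ _ h => ContinuousMap.HomotopicRel.precomp h (simplexMap ![1, 2, 0]) (by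
      rintro x ⟨i, hi⟩
      refine ⟨(![1, 2, 0] : Fin 3 → Fin 3) i, ?_⟩
      rw [simplexMap_apply_of_injective (by decide), hi])) A

/-- The operation `Q` on `Γ(M)`. -/
noncomputable def gamFlip (A : Gam s α β) : Gam s α⁻¹ (β * α) :=
  Quotient.map (sa := TwoSimplex.setoid s α β) (sb := TwoSimplex.setoid s α⁻¹ (β * α))
    TwoSimplex.flip (fun _ _ h => ContinuousMap.HomotopicRel.precomp h (simplexMap ![1, 0, 2]) (by
      rintro x ⟨i, hi⟩
      refine ⟨(![1, 0, 2] : Fin 3 → Fin 3) i, ?_⟩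
      rw [simplexMap_apply_of_injective (by decide), hi])) A

/-- The ternary operation on `Γ(M)`. -/
noncomputable def gamMul (A : Gam s α β⁻¹) (B : Gam s β γ⁻¹)
    (C : Gam s (β⁻¹ * α) (γ⁻¹ * β)) : Gam s α γ⁻¹ :=
  (exists_glues (exists_cls_eq A).choose (exists_cls_eq B).choose
    (exists_cls_eq C).choose).choose.cls

theorem gamRot_cls (a : TwoSimplex s α β) : gamRot a.cls = a.rot.cls := rfl

theorem gamFlip_cls (a : TwoSimplex s α β) : gamFlip a.cls = a.flip.cls := rfl

/-- `Glues.cls_eq` makes the arbitrary choices in `gamMul` immaterial, so that any gluing computes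
it. -/
theorem gamMul_cls {a : TwoSimplex s α β⁻¹} {b : TwoSimplex s β γ⁻¹}
    {c : TwoSimplex s (β⁻¹ * α) (γ⁻¹ * β)} {d : TwoSimplex s α γ⁻¹} (h : Glues a b c d) :
    gamMul a.cls b.cls c.cls = d.cls :=
  (exists_glues _ _ _).choose_spec.cls_eq h (exists_cls_eq a.cls).choose_spec
    (exists_cls_eq b.cls).choose_spec (exists_cls_eq c.cls).choose_spec

end Operations

theorem comp_simplexMap_eq_self {M : Type*} [TopologicalSpace M] {n : ℕ} {f : Fin n → Fin n}
    (ω : C(stdSimplex ℝ (Fin n), M)) (h : ∀ i, f i = i) : ω.comp (simplexMap f) = ω := by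
  obtain rfl : f = id := funext h
  ext x
  exact congrArg ω (stdSimplex.map_id_apply x)

/-! ### The laws of a Δ-group -/

section DeltaGroupOfSpace

open TwoSimplex

variable {M : Type*} [TopologicalSpace M] {m₀ : M} {s : LoopSection M m₀}
  {α β γ : FundamentalGroup M m₀}

/-- The vertices 1, 2, 3 are permuted cyclically: this rotates the fourth face and permutes the
other three. -/
theorem TwoSimplex.Glues.rot {a : TwoSimplex s α β⁻¹} {b : TwoSimplex s β γ⁻¹}
    {c : TwoSimplex s (β⁻¹ * α) (γ⁻¹ * β)} {d : TwoSimplex s α γ⁻¹} (h : Glues a b c d)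
    (h₁ : β⁻¹ * γ⁻¹⁻¹ = (γ⁻¹ * β)⁻¹) (h₂ : (β⁻¹ * α)⁻¹ * (γ⁻¹ * β)⁻¹ = (γ⁻¹ * α)⁻¹)
    (h₃ : β⁻¹ = (γ⁻¹ * β)⁻¹ * γ⁻¹) (h₄ : α⁻¹ * β⁻¹⁻¹ = (γ⁻¹ * α)⁻¹ * (γ⁻¹ * β))
    (h₅ : α⁻¹ * γ⁻¹⁻¹ = (γ⁻¹ * α)⁻¹) :
    Glues (b.rot.copy rfl h₁) (c.rot.copy rfl h₂) (a.rot.copy h₃ h₄) (d.rot.copy rfl h₅) := by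
  obtain ⟨ω, ha, hb, hc, hd⟩ := h
  refine ⟨ω.comp (simplexMap ![0, 2, 3, 1]), ?_, ?_, ?_, ?_⟩
  · rw [copy_toMap, rot_toMap, ← hb]
    exact comp_simplexMap_comp_eq ω (by decide)
  · rw [copy_toMap, rot_toMap, ← hc]
    exact comp_simplexMap_comp_eq ω (by decide)
  · rw [copy_toMap, rot_toMap, ← ha]
    exact comp_simplexMap_comp_eq ω (by decide)
  · rw [copy_toMap, rot_toMap, ← hd]
    exact comp_simplexMap_comp_eq ω (by decide)

/-- Exchanging the vertices 1 and 2 flips the fourth face and interchanges the faces `b` and `c`. -/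
theorem TwoSimplex.Glues.flip {a : TwoSimplex s α β⁻¹} {b : TwoSimplex s β γ⁻¹}
    {c : TwoSimplex s (β⁻¹ * α) (γ⁻¹ * β)} {d : TwoSimplex s α γ⁻¹} (h : Glues a b c d)
    (h₁ : β⁻¹ * α = (α⁻¹ * β)⁻¹) (h₂ : (β⁻¹ * α)⁻¹ = α⁻¹ * β)
    (h₃ : γ⁻¹ * β * (β⁻¹ * α) = (α⁻¹ * γ)⁻¹) (h₄ : β⁻¹ = (α⁻¹ * β)⁻¹ * α⁻¹)
    (h₅ : γ⁻¹ * β = (α⁻¹ * γ)⁻¹ * (α⁻¹ * β)) (h₆ : γ⁻¹ * α = (α⁻¹ * γ)⁻¹) :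
    Glues (a.flip.copy rfl h₁) (c.flip.copy h₂ h₃) (b.flip.copy h₄ h₅) (d.flip.copy rfl h₆) := by
  obtain ⟨ω, ha, hb, hc, hd⟩ := h
  refine ⟨ω.comp (simplexMap ![0, 2, 1, 3]), ?_, ?_, ?_, ?_⟩
  · rw [copy_toMap, flip_toMap, ← ha]
    exact comp_simplexMap_comp_eq ω (by decide)
  · rw [copy_toMap, flip_toMap, ← hc]
    exact comp_simplexMap_comp_eq ω (by decide)
  · rw [copy_toMap, flip_toMap, ← hb]
    exact comp_simplexMap_comp_eq ω (by decide)
  · rw [copy_toMap, flip_toMap, ← hd]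
    exact comp_simplexMap_comp_eq ω (by decide)

/-- The gluing of the boundary of a 4-simplex. -/
theorem TwoSimplex.Glues.assoc {δ : FundamentalGroup M m₀} {a : TwoSimplex s α β⁻¹}
    {b : TwoSimplex s β γ⁻¹} {c : TwoSimplex s (β⁻¹ * α) (γ⁻¹ * β)} {d : TwoSimplex s γ δ⁻¹}
    {e : TwoSimplex s (γ⁻¹ * α) (δ⁻¹ * γ)} {f : TwoSimplex s (γ⁻¹ * β) (δ⁻¹ * γ)}
    {abc : TwoSimplex s α γ⁻¹} {abcde : TwoSimplex s α δ⁻¹} {bdf : TwoSimplex s β δ⁻¹}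
    {h₁ : γ⁻¹ * β = (β⁻¹ * γ)⁻¹} {h₂ : (γ⁻¹ * β)⁻¹ = β⁻¹ * γ}
    {h₃ : δ⁻¹ * γ * (γ⁻¹ * β) = (β⁻¹ * δ)⁻¹} {h₄ : γ⁻¹ * α = (β⁻¹ * γ)⁻¹ * (β⁻¹ * α)}
    {h₅ : δ⁻¹ * γ = (β⁻¹ * δ)⁻¹ * (β⁻¹ * γ)} (h₆ : (β⁻¹ * δ)⁻¹ = δ⁻¹ * β)
    {cfe : TwoSimplex s (β⁻¹ * α) (β⁻¹ * δ)⁻¹} (habc : Glues a b c abc)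
    (habcde : Glues abc d e abcde) (hbdf : Glues b d f bdf)
    (hcfe : Glues (c.copy rfl h₁) (f.flip.copy h₂ h₃) (e.copy h₄ h₅) cfe) :
    Glues a bdf (cfe.copy rfl h₆) abcde := by
  obtain ⟨ω₀, ha₀, hb₀, hc₀, hd₀⟩ := habc
  obtain ⟨ω₁, ha₁, hb₁, hc₁, hd₁⟩ := habcde
  obtain ⟨ω₂, ha₂, hb₂, hc₂, hd₂⟩ := hbdf
  obtain ⟨ω₃, ha₃, hb₃, hc₃, hd₃⟩ := hcfe
  obtain ⟨W, hW⟩ := coversHorn_associativityFaces.exists_filler ![ω₀, ω₁, ω₂, ω₃]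
    (associativityFaces_compatible ![ω₀, ω₁, ω₂, ω₃] (hd₀.trans ha₁.symm) (hb₀.trans ha₂.symm)
      (hc₀.trans ha₃.symm) (hb₁.trans hb₂.symm) (hc₁.trans hc₃.symm) (by
        -- The common face of `ω₂` and `ω₃` is `f` for the former and `Q f` for the latter, so its
        -- first two vertices are read in reverse order.
        refine Eq.trans ?_ hb₃.symm
        rw [copy_toMap, flip_toMap, ← hc₂, ContinuousMap.comp_assoc, simplexMap_comp]
        exact congrArg (fun f => ω₂.comp (simplexMap f)) (by decide)))
  have hW₀ : W.comp (simplexMap ![0, 1, 2, 3]) = ω₀ := hW 0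
  have hW₁ : W.comp (simplexMap ![3, 1, 2, 4]) = ω₁ := hW 1
  have hW₂ : W.comp (simplexMap ![3, 0, 2, 4]) = ω₂ := hW 2
  have hW₃ : W.comp (simplexMap ![3, 1, 0, 4]) = ω₃ := hW 3
  -- The facet opposite to the vertex 3 shares one face with each of the four tetrahedra: `a`,
  -- `bdf`, `cfe` and `abcde`.
  refine ⟨W.comp (simplexMap ![0, 1, 2, 4]), ?_, ?_, ?_, ?_⟩
  · rw [← ha₀, ← hW₀]
    exact comp_simplexMap_comp_eq W (by decide)
  · rw [← hd₂, ← hW₂]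
    exact comp_simplexMap_comp_eq W (by decide)
  · rw [copy_toMap, ← hd₃, ← hW₃]
    exact comp_simplexMap_comp_eq W (by decide)
  · rw [← hd₁, ← hW₁]
    exact comp_simplexMap_comp_eq W (by decide)

/-- Exchanging the vertices 0 and 3 interchanges the face `a` with the glued face `d`, and changes
only the vertex order of `b` and `c`. -/
theorem TwoSimplex.Glues.inv {a : TwoSimplex s α β⁻¹} {b : TwoSimplex s β γ⁻¹}
    {c : TwoSimplex s (β⁻¹ * α) (γ⁻¹ * β)} {d : TwoSimplex s α γ⁻¹} (h : Glues a b c d)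
    (h₁ : β⁻¹⁻¹ * (γ⁻¹ * β)⁻¹ = γ) (h₂ : (γ⁻¹ * β)⁻¹ * (β⁻¹⁻¹ * (γ⁻¹ * β)⁻¹)⁻¹ = β⁻¹)
    (h₃ : γ⁻¹ * β * (β⁻¹ * α) = γ⁻¹ * α)
    (h₄ : (β⁻¹ * α)⁻¹⁻¹ * (γ⁻¹ * β * (β⁻¹ * α))⁻¹ = β⁻¹ * γ) :
    Glues d (b.flip.rot.rot.copy h₁ h₂) (c.flip.rot.copy h₃ h₄) a := by
  obtain ⟨ω, ha, hb, hc, hd⟩ := h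
  refine ⟨ω.comp (simplexMap ![3, 1, 2, 0]), ?_, ?_, ?_, ?_⟩
  · rw [← hd, ContinuousMap.comp_assoc, simplexMap_comp]
    exact congrArg (fun f => ω.comp (simplexMap f)) (by decide)
  · rw [copy_toMap, rot_toMap, rot_toMap, flip_toMap, ← hb]
    simp only [ContinuousMap.comp_assoc, simplexMap_comp]
    exact congrArg (fun f => ω.comp (simplexMap f)) (by decide)
  · rw [copy_toMap, rot_toMap, flip_toMap, ← hc]
    simp only [ContinuousMap.comp_assoc, simplexMap_comp]
    exact congrArg (fun f => ω.comp (simplexMap f)) (by decide)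
  · rw [← ha, ContinuousMap.comp_assoc, simplexMap_comp]
    exact congrArg (fun f => ω.comp (simplexMap f)) (by decide)

variable (s) in
/-- The Δ-group `Γ(M)`. -/
noncomputable def gamDeltaGroup : DeltaGroup (FundamentalGroup M m₀) (Gam s) where
  m _ _ _ := gamMul
  P := gamRot
  Q := gamFlip
  P_P_P A := by
    obtain ⟨a, rfl⟩ := exists_cls_eq A
    rw [gamRot_cls, gamRot_cls, gamRot_cls, reindex_cls]
    refine cls_eq_of_toMap_eq ?_
    simp only [copy_toMap, rot_toMap, ContinuousMap.comp_assoc, simplexMap_comp]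
    exact comp_simplexMap_eq_self _ (by decide)
  Q_Q A := by
    obtain ⟨a, rfl⟩ := exists_cls_eq A
    rw [gamFlip_cls, gamFlip_cls, reindex_cls]
    refine cls_eq_of_toMap_eq ?_
    simp only [copy_toMap, flip_toMap, ContinuousMap.comp_assoc, simplexMap_comp]
    exact comp_simplexMap_eq_self _ (by decide)
  P_P_Q A := by
    obtain ⟨a, rfl⟩ := exists_cls_eq A
    rw [gamFlip_cls, gamRot_cls, gamRot_cls, gamRot_cls, gamFlip_cls, reindex_cls]
    refine cls_eq_of_toMap_eq ?_
    simp only [copy_toMap, rot_toMap, flip_toMap, ContinuousMap.comp_assoc, simplexMap_comp]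
    exact congrArg (fun f => a.toMap.comp (simplexMap f)) (by decide)
  P_m g h k A B C := by
    obtain ⟨a, rfl⟩ := exists_cls_eq A
    obtain ⟨b, rfl⟩ := exists_cls_eq B
    obtain ⟨c, rfl⟩ := exists_cls_eq C
    obtain ⟨d, hd⟩ := exists_glues a b c
    rw [gamMul_cls hd, gamRot_cls, gamRot_cls, gamRot_cls, gamRot_cls, reindex_cls, reindex_cls,
      reindex_cls, gamMul_cls (hd.rot _ _ _ _ (by group)), reindex_cls]
    exact cls_eq_of_toMap_eq rfl
  Q_m g h k A B C := by
    obtain ⟨a, rfl⟩ := exists_cls_eq A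
    obtain ⟨b, rfl⟩ := exists_cls_eq B
    obtain ⟨c, rfl⟩ := exists_cls_eq C
    obtain ⟨d, hd⟩ := exists_glues a b c
    rw [gamMul_cls hd, gamFlip_cls, gamFlip_cls, gamFlip_cls, gamFlip_cls, reindex_cls,
      reindex_cls, reindex_cls, gamMul_cls (hd.flip _ _ _ _ _ (by group)), reindex_cls]
    exact cls_eq_of_toMap_eq rfl
  m_m g h k l A B C D E F := by
    obtain ⟨a, rfl⟩ := exists_cls_eq A
    obtain ⟨b, rfl⟩ := exists_cls_eq B
    obtain ⟨c, rfl⟩ := exists_cls_eq C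
    obtain ⟨d, rfl⟩ := exists_cls_eq D
    obtain ⟨e, rfl⟩ := exists_cls_eq E
    obtain ⟨f, rfl⟩ := exists_cls_eq F
    obtain ⟨x, hx⟩ := exists_glues a b c
    obtain ⟨y, hy⟩ := exists_glues x d e
    obtain ⟨z, hz⟩ := exists_glues b d f
    rw [gamMul_cls hx, gamMul_cls hy, gamMul_cls hz, gamFlip_cls, reindex_cls, reindex_cls,
      reindex_cls]
    obtain ⟨w, hw⟩ := exists_glues (c.copy rfl (by group : k⁻¹ * h = (h⁻¹ * k)⁻¹))
      (f.flip.copy (by group : (k⁻¹ * h)⁻¹ = h⁻¹ * k)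
        (by group : l⁻¹ * k * (k⁻¹ * h) = (h⁻¹ * l)⁻¹))
      (e.copy (by group : k⁻¹ * g = (h⁻¹ * k)⁻¹ * (h⁻¹ * g))
        (by group : l⁻¹ * k = (h⁻¹ * l)⁻¹ * (h⁻¹ * k)))
    rw [gamMul_cls hw, reindex_cls, gamMul_cls (TwoSimplex.Glues.assoc _ hx hy hz hw)]
  m_inv g h k F A B := by
    obtain ⟨a, rfl⟩ := exists_cls_eq A
    obtain ⟨b, rfl⟩ := exists_cls_eq B
    obtain ⟨f, rfl⟩ := exists_cls_eq F
    obtain ⟨d, hd⟩ := exists_glues f a b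
    rw [gamMul_cls hd, gamFlip_cls, gamFlip_cls, gamRot_cls, gamRot_cls, gamRot_cls, reindex_cls,
      reindex_cls, gamMul_cls (hd.inv _ _ _ _)]

theorem isGamma_gamDeltaGroup : IsGamma s (gamDeltaGroup s) where
  P_cls _ := rfl
  Q_cls _ := rfl
  exists_glues := exists_glues
  m_cls _ _ _ _ h := gamMul_cls h

end DeltaGroupOfSpace

/-! ### The induced morphism -/

section InducedMorphism

open TwoSimplex

variable {M N : Type*} [TopologicalSpace M] [TopologicalSpace N] {m₀ : M} {n₀ : N}
  {s : LoopSection M m₀} {s' : LoopSection N n₀} {f : C(M, N)} {c : Path (f m₀) n₀}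

namespace EdgeHomotopies

variable (E : EdgeHomotopies s s' f c) {α β γ : FundamentalGroup M m₀}

/-- A homotopy of `f ∘ a` that extends the chosen homotopies of the edges ends in a 2-simplex. -/
theorem exists_carries_of_homotopy (a : TwoSimplex s α β) (K : C(I × stdSimplex ℝ (Fin 3), N))
    (h₀ : ∀ x, K (0, x) = f (a.toMap x)) (h₀₁ : ∀ u t, K (u, simplexEdge 0 1 t) = E.H α (u, t))
    (h₁₂ : ∀ u t, K (u, simplexEdge 1 2 t) = E.H β (u, t))
    (h₀₂ : ∀ u t, K (u, simplexEdge 0 2 t) = E.H (β * α) (u, t)) :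
    ∃ b : TwoSimplex s' (inducedHom f c α) (inducedHom f c β),
      E.Carries a b ∧ ∀ x, b.toMap x = K (1, x) := by
  refine ⟨⟨K.comp ⟨fun x => (1, x), by fun_prop⟩, fun t => ?_, fun t => ?_, fun t => ?_⟩,
    ⟨⟨K, h₀, fun _ => rfl⟩, fun u t => ⟨h₀₁ u t, h₁₂ u t, h₀₂ u t⟩⟩, fun _ => rfl⟩
  · exact (h₀₁ 1 t).trans (E.at_one α t)
  · exact (h₁₂ 1 t).trans (E.at_one β t)
  · rw [← map_mul]
    exact (h₀₂ 1 t).trans (E.at_one (β * α) t)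

theorem exists_carries (a : TwoSimplex s α β) :
    ∃ b : TwoSimplex s' (inducedHom f c α) (inducedHom f c β), E.Carries a b := by
  let p : C(Unit × (I × I), I × I) := ⟨Prod.snd, by fun_prop⟩
  obtain ⟨G, h₀, h₀₁, h₁₂, h₀₂⟩ := exists_prism_extension (Z := Unit)
    ((f.comp a.toMap).comp ⟨Prod.snd, by fun_prop⟩) ((E.H α).comp p) ((E.H β).comp p)
    ((E.H (β * α)).comp p)
    (fun _ u => (E.source α u).trans (E.source _ u).symm)
    (fun _ u => (E.target α u).trans (E.source _ u).symm)
    (fun _ u => (E.target β u).trans (E.target _ u).symm)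
    (fun _ t => (E.at_zero α t).trans (congrArg f (a.edge01 t).symm))
    (fun _ t => (E.at_zero β t).trans (congrArg f (a.edge12 t).symm))
    (fun _ t => (E.at_zero _ t).trans (congrArg f (a.edge02 t).symm))
  obtain ⟨b, hb, -⟩ := E.exists_carries_of_homotopy a
    (G.comp ⟨fun q => ((), q), by fun_prop⟩) (fun x => h₀ () x) (fun u t => h₀₁ () u t)
    (fun u t => h₁₂ () u t) (fun u t => h₀₂ () u t)
  exact ⟨b, hb⟩

variable {E}

/-- The homotopy from `a` to `a'` has parameter `z`, and the edge homotopies, independent of `z`,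
are extended over all its stages at once. Moving `z` from 0 to 1 then joins the tops relative to the
boundary. -/
theorem Carries.cls_eq {a a' : TwoSimplex s α β}
    {b b' : TwoSimplex s' (inducedHom f c α) (inducedHom f c β)} (h : E.Carries a b)
    (h' : E.Carries a' b') (ha : a.cls = a'.cls) : b.cls = b'.cls := by
  rw [cls_eq_iff] at ha ⊢
  obtain ⟨A⟩ := ha
  obtain ⟨K, hK⟩ := h
  obtain ⟨K', hK'⟩ := h'
  have hA (z : I) (i j : Fin 3) (t : I) :
      A (z, simplexEdge i j t) = a.toMap (simplexEdge i j t) :=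
    A.eq_fst z (simplexEdge_mem_boundary i j t)
  let p : C(I × (I × I), I × I) := ⟨Prod.snd, by fun_prop⟩
  obtain ⟨G, h₀, h₀₁, h₁₂, h₀₂⟩ := exists_prism_extension (Z := I)
    (f.comp A.toContinuousMap) ((E.H α).comp p) ((E.H β).comp p) ((E.H (β * α)).comp p)
    (fun _ u => (E.source α u).trans (E.source _ u).symm)
    (fun _ u => (E.target α u).trans (E.source _ u).symm)
    (fun _ u => (E.target β u).trans (E.target _ u).symm)
    (fun z t => (E.at_zero α t).trans (congrArg f ((hA z 0 1 t).trans (a.edge01 t)).symm))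
    (fun z t => (E.at_zero β t).trans (congrArg f ((hA z 1 2 t).trans (a.edge12 t)).symm))
    (fun z t => (E.at_zero _ t).trans (congrArg f ((hA z 0 2 t).trans (a.edge02 t)).symm))
  have hside (z u : I) (x : stdSimplex ℝ (Fin 3)) (hx : x ∈ simplexBoundary 3) :
      G (z, u, x) = K (u, x) ∧ G (z, u, x) = K' (u, x) := by
    rcases exists_simplexEdge_eq hx with ⟨t, rfl⟩ | ⟨t, rfl⟩ | ⟨t, rfl⟩
    · rw [h₀₁, (hK u t).1, (hK' u t).1]
      exact ⟨rfl, rfl⟩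
    · rw [h₁₂, (hK u t).2.1, (hK' u t).2.1]
      exact ⟨rfl, rfl⟩
    · rw [h₀₂, (hK u t).2.2, (hK' u t).2.2]
      exact ⟨rfl, rfl⟩
  let G' (z : I) : C(I × stdSimplex ℝ (Fin 3), N) := G.comp ⟨fun q => (z, q), by fun_prop⟩
  -- The given prism `K` and the stage `z = 0` agree on bottom and sides, so their tops are
  -- homotopic relative to the boundary; likewise `K'` and `z = 1`.
  have hG₀ : K.toContinuousMap.HomotopicRel (G' 0) {q | q.1 = 0 ∨ q.2 ∈ simplexBoundary 3} := by
    refine isBoxRetraction_boxRetraction.homotopicRel_of_eqOn ?_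
    rintro ⟨u, x⟩ (hu | hx)
    · obtain rfl : u = 0 := hu
      exact (K.apply_zero x).trans ((h₀ 0 x).trans (congrArg f (A.apply_zero x))).symm
    · exact (hside 0 u x hx).1.symm
  have hG₁ : (G' 1).HomotopicRel K'.toContinuousMap {q | q.1 = 0 ∨ q.2 ∈ simplexBoundary 3} := by
    refine isBoxRetraction_boxRetraction.homotopicRel_of_eqOn ?_
    rintro ⟨u, x⟩ (hu | hx)
    · obtain rfl : u = 0 := hu
      exact ((h₀ 1 x).trans (congrArg f (A.apply_one x))).trans (K'.apply_zero x).symm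
    · exact (hside 1 u x hx).2
  let top : C(stdSimplex ℝ (Fin 3), I × stdSimplex ℝ (Fin 3)) := ⟨fun x => (1, x), by fun_prop⟩
  have htop : Set.MapsTo top (simplexBoundary 3) {q | q.1 = 0 ∨ q.2 ∈ simplexBoundary 3} :=
    fun x hx => .inr hx
  have hmid : ((G' 0).comp top).HomotopicRel ((G' 1).comp top) (simplexBoundary 3) :=
    ⟨{ toFun := fun q => G (q.1, 1, q.2)
       continuous_toFun := by fun_prop
       map_zero_left := fun _ => rfl
       map_one_left := fun _ => rfl
       prop' := fun z x hx => (hside z 1 x hx).1.trans (hside 0 1 x hx).1.symm }⟩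
  have hb : b.toMap = K.toContinuousMap.comp top :=
    ContinuousMap.ext fun x => (K.apply_one x).symm
  have hb' : b'.toMap = K'.toContinuousMap.comp top :=
    ContinuousMap.ext fun x => (K'.apply_one x).symm
  rw [hb, hb']
  exact ((hG₀.precomp top htop).trans hmid).trans (hG₁.precomp top htop)

/-- The same homotopy is read in rotated coordinates; two edges are then traversed backwards, which
`E.inv` accounts for. -/
theorem Carries.rot {a : TwoSimplex s α β}
    {b : TwoSimplex s' (inducedHom f c α) (inducedHom f c β)} (h : E.Carries a b)
    (e : (inducedHom f c α)⁻¹ * (inducedHom f c β)⁻¹ = inducedHom f c (α⁻¹ * β⁻¹)) :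
    E.Carries a.rot (b.rot.copy rfl e) := by
  obtain ⟨K, hK⟩ := h
  refine ⟨K.compContinuousMap (simplexMap ![1, 2, 0]), fun u t => ?_⟩
  change K (u, simplexMap ![1, 2, 0] _) = _ ∧ K (u, simplexMap ![1, 2, 0] _) = _ ∧
    K (u, simplexMap ![1, 2, 0] _) = _
  rw [simplexMap_edge, simplexMap_edge, simplexMap_edge]
  refine ⟨(hK u t).2.1, ?_, ?_⟩
  · change K (u, simplexEdge 2 0 t) = _
    rw [simplexEdge_symm, (hK u (σ t)).2.2, ← mul_inv_rev, E.inv]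
  · change K (u, simplexEdge 1 0 t) = _
    rw [simplexEdge_symm, (hK u (σ t)).1, inv_mul_cancel_right, E.inv]

theorem Carries.flip {a : TwoSimplex s α β}
    {b : TwoSimplex s' (inducedHom f c α) (inducedHom f c β)} (h : E.Carries a b)
    (e₁ : (inducedHom f c α)⁻¹ = inducedHom f c α⁻¹)
    (e₂ : inducedHom f c β * inducedHom f c α = inducedHom f c (β * α)) :
    E.Carries a.flip (b.flip.copy e₁ e₂) := by
  obtain ⟨K, hK⟩ := h
  refine ⟨K.compContinuousMap (simplexMap ![1, 0, 2]), fun u t => ?_⟩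
  change K (u, simplexMap ![1, 0, 2] _) = _ ∧ K (u, simplexMap ![1, 0, 2] _) = _ ∧
    K (u, simplexMap ![1, 0, 2] _) = _
  rw [simplexMap_edge, simplexMap_edge, simplexMap_edge]
  refine ⟨?_, (hK u t).2.2, ?_⟩
  · change K (u, simplexEdge 1 0 t) = _
    rw [simplexEdge_symm, (hK u (σ t)).1, E.inv]
  · rw [mul_inv_cancel_right]
    exact (hK u t).2.1

/-- The homotopies of three faces extend to one of `f ∘ ω`. Its end is a tetrahedron gluing the
images, and its restriction to the fourth face carries `w` to the glued face. -/
theorem Carries.exists_glues {a : TwoSimplex s α β⁻¹} {b : TwoSimplex s β γ⁻¹}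
    {d : TwoSimplex s (β⁻¹ * α) (γ⁻¹ * β)} {w : TwoSimplex s α γ⁻¹}
    {a' : TwoSimplex s' (inducedHom f c α) (inducedHom f c β⁻¹)}
    {b' : TwoSimplex s' (inducedHom f c β) (inducedHom f c γ⁻¹)}
    {d' : TwoSimplex s' (inducedHom f c (β⁻¹ * α)) (inducedHom f c (γ⁻¹ * β))}
    (ha : E.Carries a a') (hb : E.Carries b b') (hd : E.Carries d d') (h : Glues a b d w)
    (e₁ : inducedHom f c β⁻¹ = (inducedHom f c β)⁻¹)
    (e₂ : inducedHom f c γ⁻¹ = (inducedHom f c γ)⁻¹)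
    (e₃ : inducedHom f c (β⁻¹ * α) = (inducedHom f c β)⁻¹ * inducedHom f c α)
    (e₄ : inducedHom f c (γ⁻¹ * β) = (inducedHom f c γ)⁻¹ * inducedHom f c β) :
    ∃ w' : TwoSimplex s' (inducedHom f c α) (inducedHom f c γ⁻¹), E.Carries w w' ∧
      Glues (a'.copy rfl e₁) (b'.copy rfl e₂) (d'.copy e₃ e₄) (w'.copy rfl e₂) := by
  obtain ⟨Ka, hKa⟩ := ha
  obtain ⟨Kb, hKb⟩ := hb
  obtain ⟨Kd, hKd⟩ := hd
  obtain ⟨ω, hωa, hωb, hωd, hωw⟩ := h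
  obtain ⟨G, hG₀, hG⟩ := coversHorn_gluingFaces.exists_homotopy (f.comp ω)
    ![Ka.toContinuousMap, Kb.toContinuousMap, Kd.toContinuousMap]
    (fun i j hij x y u => gluingFaces_compatible
      (fun i x => ![Ka.toContinuousMap, Kb.toContinuousMap, Kd.toContinuousMap] i (u, x))
      (fun t => by
        change Ka (u, _) = Kb (u, _)
        rw [simplexEdge_symm, (hKa u _).2.1, (hKb u t).1, E.inv, unitInterval.symm_symm])
      (fun t => by
        change Ka (u, _) = Kd (u, _)
        rw [(hKa u t).2.2, (hKd u t).1])
      (fun t => by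
        change Kb (u, _) = Kd (u, _)
        rw [(hKb u t).2.2, (hKd u t).2.1]) i j hij x y)
    (by
      intro i x
      fin_cases i
      · exact (Ka.apply_zero x).trans
          (congrArg (fun g : C(stdSimplex ℝ (Fin 3), M) => f (g x)) hωa.symm)
      · exact (Kb.apply_zero x).trans
          (congrArg (fun g : C(stdSimplex ℝ (Fin 3), M) => f (g x)) hωb.symm)
      · exact (Kd.apply_zero x).trans
          (congrArg (fun g : C(stdSimplex ℝ (Fin 3), M) => f (g x)) hωd.symm))
  have hGa (u : I) (x) : G (u, simplexMap ![1, 2, 0] x) = Ka (u, x) := hG 0 u x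
  have hGb (u : I) (x) : G (u, simplexMap ![0, 2, 3] x) = Kb (u, x) := hG 1 u x
  have hGd (u : I) (x) : G (u, simplexMap ![1, 0, 3] x) = Kd (u, x) := hG 2 u x
  obtain ⟨w', hw', hw'G⟩ := E.exists_carries_of_homotopy w
    (G.comp ⟨fun q => (q.1, simplexMap ![1, 2, 3] q.2), by fun_prop⟩)
    (fun x => (hG₀ _).trans (congrArg (fun g : C(stdSimplex ℝ (Fin 3), M) => f (g x)) hωw))
    (fun u t => by
      rw [← (hKa u t).1, ← hGa, simplexMap_edge]
      change G (u, simplexMap ![1, 2, 3] _) = _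
      rw [simplexMap_edge]
      rfl)
    (fun u t => by
      rw [← (hKb u t).2.1, ← hGb, simplexMap_edge]
      change G (u, simplexMap ![1, 2, 3] _) = _
      rw [simplexMap_edge]
      rfl)
    (fun u t => by
      rw [show γ⁻¹ * α = γ⁻¹ * β * (β⁻¹ * α) by group, ← (hKd u t).2.2, ← hGd, simplexMap_edge]
      change G (u, simplexMap ![1, 2, 3] _) = _
      rw [simplexMap_edge]
      rfl)
  refine ⟨w', hw', G.comp ⟨fun x => (1, x), by fun_prop⟩, ?_, ?_, ?_, ?_⟩ <;>
    refine ContinuousMap.ext fun x => ?_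
  · exact (hGa 1 x).trans (Ka.apply_one x)
  · exact (hGb 1 x).trans (Kb.apply_one x)
  · exact (hGd 1 x).trans (Kd.apply_one x)
  · exact (hw'G x).symm

variable (E) in
/-- The map `Γ(α, β) → Γ(f_* α, f_* β)` induced by `f` through the chosen homotopies of curves. -/
noncomputable def gamMap (A : Gam s α β) : Gam s' (inducedHom f c α) (inducedHom f c β) :=
  (E.exists_carries (exists_cls_eq A).choose).choose.cls

theorem Carries.gamMap_cls {a : TwoSimplex s α β}
    {b : TwoSimplex s' (inducedHom f c α) (inducedHom f c β)} (h : E.Carries a b) :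
    E.gamMap a.cls = b.cls :=
  (E.exists_carries _).choose_spec.cls_eq h (exists_cls_eq a.cls).choose_spec

end EdgeHomotopies

/-- The morphism of Δ-groups induced by a continuous map. -/
noncomputable def EdgeHomotopies.hom (E : EdgeHomotopies s s' f c)
    {D : DeltaGroup (FundamentalGroup M m₀) (Gam s)}
    {D' : DeltaGroup (FundamentalGroup N n₀) (Gam s')} (hD : IsGamma s D) (hD' : IsGamma s' D') :
    DeltaGroup.Hom (inducedHom f c) D D' where
  map := E.gamMap
  map_P A := by
    obtain ⟨a, rfl⟩ := exists_cls_eq A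
    obtain ⟨b, hb⟩ := E.exists_carries a
    rw [hD.P_cls, hb.gamMap_cls, hD'.P_cls,
      (hb.rot (by rw [map_mul, map_inv, map_inv])).gamMap_cls, reindex_cls]
    exact cls_eq_of_toMap_eq rfl
  map_Q A := by
    obtain ⟨a, rfl⟩ := exists_cls_eq A
    obtain ⟨b, hb⟩ := E.exists_carries a
    rw [hD.Q_cls, hb.gamMap_cls, hD'.Q_cls,
      (hb.flip (map_inv _ _).symm (map_mul _ _ _).symm).gamMap_cls, reindex_cls]
    exact cls_eq_of_toMap_eq rfl
  map_m g h k A B C := by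
    obtain ⟨a, rfl⟩ := exists_cls_eq A
    obtain ⟨b, rfl⟩ := exists_cls_eq B
    obtain ⟨d, rfl⟩ := exists_cls_eq C
    obtain ⟨w, hw⟩ := exists_glues a b d
    obtain ⟨a', ha'⟩ := E.exists_carries a
    obtain ⟨b', hb'⟩ := E.exists_carries b
    obtain ⟨d', hd'⟩ := E.exists_carries d
    obtain ⟨w', hw', hglue⟩ := ha'.exists_glues hb' hd' hw (map_inv _ _) (map_inv _ _)
      (by rw [map_mul, map_inv]) (by rw [map_mul, map_inv])
    rw [hD.m_cls _ _ _ _ hw, hw'.gamMap_cls, ha'.gamMap_cls, hb'.gamMap_cls, hd'.gamMap_cls,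
      reindex_cls, reindex_cls, reindex_cls, reindex_cls]
    exact (hD'.m_cls _ _ _ _ hglue).symm

theorem EdgeHomotopies.isInduced_hom (E : EdgeHomotopies s s' f c)
    {D : DeltaGroup (FundamentalGroup M m₀) (Gam s)}
    {D' : DeltaGroup (FundamentalGroup N n₀) (Gam s')} (hD : IsGamma s D) (hD' : IsGamma s' D') :
    IsInduced E (E.hom hD hD') where
  exists_carries := E.exists_carries
  map_cls _ _ h := h.gamMap_cls

end InducedMorphism

theorem mainTheorem1 :
    (∀ (M : Type*) [TopologicalSpace M] (m₀ : M),
      (∀ α : FundamentalGroup M m₀, orderOf α ≠ 2) →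
      Nonempty (LoopSection M m₀) ∧
      ∀ s : LoopSection M m₀,
        (∀ α β : FundamentalGroup M m₀, Nonempty (Gam s α β)) ∧
        ∃ D : DeltaGroup (FundamentalGroup M m₀) (Gam s), IsGamma s D) ∧
    (∀ (M N : Type*) [TopologicalSpace M] [TopologicalSpace N] (m₀ : M) (n₀ : N),
      (∀ α : FundamentalGroup M m₀, orderOf α ≠ 2) →
      (∀ α : FundamentalGroup N n₀, orderOf α ≠ 2) →
      ∀ (s : LoopSection M m₀) (s' : LoopSection N n₀)
        (D : DeltaGroup (FundamentalGroup M m₀) (Gam s))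
        (D' : DeltaGroup (FundamentalGroup N n₀) (Gam s')),
        IsGamma s D → IsGamma s' D' →
        ∀ (f : C(M, N)) (c : Path (f m₀) n₀),
          Nonempty (EdgeHomotopies s s' f c) ∧
          ∀ E : EdgeHomotopies s s' f c,
            ∃ F : DeltaGroup.Hom (inducedHom f c) D D', IsInduced E F) :=
  ⟨fun _ _ _ hM => ⟨LoopSection.nonempty_of_orderOf_ne_two hM, fun s =>
    ⟨nonempty_Gam s, gamDeltaGroup s, isGamma_gamDeltaGroup⟩⟩,
   fun _ _ _ _ _ _ hM _ s s' _ _ hD hD' f c =>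
    ⟨EdgeHomotopies.nonempty_of_orderOf_ne_two hM s s' f c, fun E =>
      ⟨E.hom hD hD', E.isInduced_hom hD hD'⟩⟩⟩
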